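/- Theorem. For $\tau$ in the upper half-plane $\mathbb H$ let $q=e^{2\pi i\tau}$, let $\eta(\tau)=q^{1/24}\prod_{j\ge1}(1-q^j)$ with $q^{1/24}=e^{2\pi i\tau/24}$, and put $$Z=\Bigl(\sum_{m=-\infty}^{\infty}\sum_{n=-\infty}^{\infty}q^{m^2+5n^2}\Bigr)^2,\qquad z=\eta(2\tau)^2\,\eta(10\tau)^2,\qquad X=\frac{z}{Z}.$$ For functions of $\tau$ write $\dfrac{df}{dX}=\dfrac{df}{d\tau}\Big/\dfrac{dX}{d\tau}$. The points of $\mathbb H$ at which $Z=0$ or $dX/d\tau=0$ form a set without accumulation points in $\mathbb H$, and at every other point of $\mathbb H$ $$X^{2}(1-4X)(1-12X+16X^{2})\frac{d^{3}Z}{dX^{3}}+3X(1-24X+128X^{2}-160X^{3})\frac{d^{2}Z}{dX^{2}}+(1-56X+464X^{2}-784X^{3})\frac{dZ}{dX}-4(1-20X+54X^{2})Z=0.$$ Equivalently, with $Z_X=X\frac{dZ}{dX}$, $Z_{XX}=\bigl(X\frac{d}{dX}\bigr)^2Z$, $Z_{XXX}=\bigl(X\frac{d}{dX}\bigr)^3Z$,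 at the same points $$4X(54X^2-20X+1)Z+16X(27X^2-13X+1)Z_X+24X(2X-1)(6X-1)Z_{XX}+(4X-1)(16X^2-12X+1)Z_{XXX}=0.$$ -/

import Mathlib

noncomputable section

namespace LevelTwenty

open Complex

/-- The nome `q = e^{2πiτ}`. -/
def nome (τ : ℂ) : ℂ := exp (2 * Real.pi * I * τ)

/-- `Z = (∑_{m ∈ ℤ} ∑_{n ∈ ℤ} q^{m² + 5n²})²`, as a function of `τ`. -/
def Z (τ : ℂ) : ℂ := (∑' m : ℤ, ∑' n : ℤ, nome τ ^ (m ^ 2 + 5 * n ^ 2)) ^ 2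

/-- `z = η(2τ)² η(10τ)²`. -/
def z (τ : ℂ) : ℂ := ModularForm.eta (2 * τ) ^ 2 * ModularForm.eta (10 * τ) ^ 2

/-- `X = z / Z`. -/
def X (τ : ℂ) : ℂ := z τ / Z τ

/-- The derivation `d/dX` on functions of `τ`: `df/dX = (df/dτ) / (dX/dτ)`. It is meaningful near
every point where `X` is holomorphic with `dX/dτ ≠ 0`, that is, where `X` is a local coordinate. -/
def dX (f : ℂ → ℂ) (τ : ℂ) : ℂ := deriv f τ / deriv X τ

/-- The operator `X d/dX` on functions of `τ`. -/
def eulerX (f : ℂ → ℂ) (τ : ℂ) : ℂ := X τ * dX f τ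

end LevelTwenty

end

/-!
# The third-order differential equation at level twenty

Put `t = 2τ`, `q = e^{πit}`, `D = q d/dq = (πi)⁻¹ d/dt`, and write
`p = θ₂(t)²θ₂(5t)²`, `r = θ₄(t)²θ₄(5t)²`, `Z = θ₃(t)²θ₃(5t)²`, `z = η(t)²η(5t)²`
for the weight-two products (`theta2Prod`, `theta4Prod`, `theta3Prod`, `etaProd`). The proof
describes the action of `D` on these four functions and on `D log Z`.

Every modular input comes from one principle, `eq_zero_of_levelOne`: a holomorphic function with the
transformation behaviour of a level-one form of weight below `12` which tends to `0` at the cusp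
is zero. Applied to symmetric functions of objects permuted by `SL₂(ℤ)` it gives `θ₂θ₃θ₄ = 2η³`
(squared), Jacobi's identity, the logarithmic derivatives of the theta constants (`logDeriv_theta`),
Ramanujan's equation for `E₂` (`hasDerivAt_dlogEtaSq`), and the modular equation of degree five
`Z = p + r + 8z` (`modular_equation`). For the last one, `(Z - p - r)/(8z)` is invariant under
`Γ₀(5)` and its six transforms under `SL₂(ℤ)` all tend to `1` at the cusp.

The rest is algebra and differentiation. Since also `prZ = 16z³`, the numbers `p/Z` and `r/Z` are the
roots of `T² - (1 - 8X)T + 16X³`, whose discriminant is `P(X) = (1 - 4X)(1 - 12X + 16X²)`.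
Differentiating the modular equation determines `θ₂(t)⁴ + 5θ₂(5t)⁴` and `θ₄(t)⁴ + 5θ₄(5t)⁴`
(`theta2Sum_eq`, `theta4Sum_eq`), whence `D log X = r - p` and `(D log X)² = Z²P(X)`.
Differentiating once more determines `(D log η(t)² - D log η(5t)²)²` (`dlogEtaSq_sub_sq`), and with
Ramanujan's equation this yields
`2 D²(log Z) - (D log Z)² = Z²R(X)` with `R = 8X - 80X² + 144X³`
(`hasDerivAt_dlogTheta3Prod`). In terms of `ϑ = X d/dX` the two relations say
`2PZ·ϑ²Z - P(ϑZ)² + Z·ϑP·ϑZ = Z²R` (`eulerX_quadratic`); applying `ϑ` and dividing by `Z` gives the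
third-order linear equation. The function `Z` has no zeros because `prZ = 16z³` and `η` has none,
and `D log X` tends to `1` at the cusp, so its zeros are isolated.
-/

noncomputable section

namespace LevelTwenty

open Complex Filter Topology
open scoped Real MatrixGroups UpperHalfPlane ModularForm

/-! ### Level-one forms of small weight -/

/-- The filter of complex numbers whose imaginary part tends to `+∞`. -/
abbrev cuspInfty : Filter ℂ := comap Complex.im atTop

/-- A holomorphic function on the upper half-plane which transforms like a level-one modular form
of weight `k < 12` and tends to `0` at the cusp vanishes: it is a cusp form of weight below `12`. -/
theorem eq_zero_of_levelOne {k : ℕ} (hk : k < 12) {f : ℂ → ℂ}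
    (hd : DifferentiableOn ℂ f {t | 0 < t.im})
    (hT : ∀ t : ℂ, 0 < t.im → f (t + 1) = f t)
    (hS : ∀ t : ℂ, 0 < t.im → f (-1 / t) = t ^ k * f t)
    (h0 : Tendsto f cuspInfty (𝓝 0)) {t : ℂ} (ht : 0 < t.im) : f t = 0 := by
  have hslashS : ((fun τ : ℍ => f τ) ∣[(k : ℤ)] ModularGroup.S) = fun τ : ℍ => f τ := by
    ext τ
    rw [ModularForm.SL_slash_apply, UpperHalfPlane.modular_S_smul]
    have h1 := hS τ τ.2
    have hne : (τ : ℂ) ≠ 0 := τ.ne_zero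
    rw [ModularGroup.denom_S]
    simp only [zpow_neg, zpow_natCast]
    rw [show (-(τ : ℂ))⁻¹ = -1 / (τ : ℂ) by simp [neg_div, inv_neg], h1]
    field_simp
  have hslashT : ((fun τ : ℍ => f τ) ∣[(k : ℤ)] ModularGroup.T) = fun τ : ℍ => f τ := by
    ext τ
    rw [ModularForm.SL_slash_apply, UpperHalfPlane.modular_T_smul, ModularGroup.denom_apply]
    have h1 := hT τ τ.2
    simp [ModularGroup.T, add_comm, h1]
  have hinv := fun A : SL(2, ℤ) =>
    SlashInvariantForm.slash_action_generators_SL2Z hslashS hslashT A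
  let F : CuspForm 𝒮ℒ (k : ℤ) :=
    { toFun := fun τ : ℍ => f τ
      slash_action_eq' := by
        rintro _ ⟨A, rfl⟩
        exact hinv A
      holo' := by
        rw [UpperHalfPlane.mdifferentiable_iff]
        exact hd.congr fun z hz => by simp [UpperHalfPlane.ofComplex_apply_of_im_pos hz]
      zero_at_cusps' := by
        intro c hc
        rw [Subgroup.IsArithmetic.isCusp_iff_isCusp_SL2Z] at hc
        rw [OnePoint.isZeroAt_iff_forall_SL2Z hc]
        intro γ _
        rw [hinv]
        exact h0.comp UpperHalfPlane.tendsto_coe_atImInfty }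
  have hF : F = 0 :=
    rank_zero_iff_forall_zero.mp (CuspForm.rank_eq_zero_of_weight_lt_twelve (by exact_mod_cast hk)) F
  exact congrArg (fun G : CuspForm 𝒮ℒ (k : ℤ) => G (⟨t, ht⟩ : ℍ)) hF

/-! ### Squares of the theta constants and of the eta function -/

/-- `θ₂²`, where `θ₂(t) = ∑ₙ e^{πi (n + 1/2)² t}`. -/
def theta2Sq (t : ℂ) : ℂ := (exp (π * I * t / 4) * jacobiTheta₂ (t / 2) t) ^ 2

/-- `θ₃²`, where `θ₃(t) = ∑ₙ e^{πi n² t}`. -/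
def theta3Sq (t : ℂ) : ℂ := jacobiTheta t ^ 2

/-- `θ₄²`, where `θ₄(t) = ∑ₙ (-1)ⁿ e^{πi n² t} = θ₃(t + 1)`. -/
def theta4Sq (t : ℂ) : ℂ := jacobiTheta (t + 1) ^ 2

/-- `η²`. -/
def etaSq (t : ℂ) : ℂ := ModularForm.eta t ^ 2

theorem neg_one_div_im_pos {t : ℂ} (ht : 0 < t.im) : 0 < (-1 / t).im := by
  have h := UpperHalfPlane.im_inv_neg_coe_pos ⟨t, ht⟩
  simpa [neg_div, inv_neg] using h

theorem ne_zero_of_im_pos {t : ℂ} (ht : 0 < t.im) : t ≠ 0 := by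
  rintro rfl
  simp at ht

theorem jacobiTheta_add_two (t : ℂ) : jacobiTheta (t + 2) = jacobiTheta t := by
  rw [add_comm, jacobiTheta_two_add]

theorem theta3Sq_add_one (t : ℂ) : theta3Sq (t + 1) = theta4Sq t := rfl

theorem theta4Sq_add_one (t : ℂ) : theta4Sq (t + 1) = theta3Sq t := by
  rw [theta4Sq, theta3Sq, show t + 1 + 1 = t + 2 by ring, jacobiTheta_add_two]

theorem jacobiTheta_add_one_eq (t : ℂ) : jacobiTheta (t + 1) = jacobiTheta₂ (1 / 2) t := by
  rw [jacobiTheta_eq_jacobiTheta₂, jacobiTheta₂, jacobiTheta₂]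
  refine tsum_congr fun n => ?_
  rw [jacobiTheta₂_term, jacobiTheta₂_term, Complex.exp_eq_exp_iff_exists_int]
  obtain ⟨m, hm⟩ := Int.even_mul_pred_self n
  refine ⟨m, ?_⟩
  have : (n : ℂ) * (n - 1) = m + m := by exact_mod_cast hm
  linear_combination (π * I : ℂ) * this

theorem theta2Sq_add_one (t : ℂ) : theta2Sq (t + 1) = I * theta2Sq t := by
  have h : jacobiTheta₂ ((t + 1) / 2) (t + 1) = jacobiTheta₂ (t / 2) t := by
    refine tsum_congr fun n => ?_
    rw [jacobiTheta₂_term, jacobiTheta₂_term, Complex.exp_eq_exp_iff_exists_int]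
    obtain ⟨m, hm⟩ := Int.even_mul_succ_self n
    refine ⟨m, ?_⟩
    have : (n : ℂ) * (n + 1) = m + m := by exact_mod_cast hm
    linear_combination (π * I : ℂ) * this
  have h2 : exp (π * I * (t + 1) / 4) ^ 2 = I * exp (π * I * t / 4) ^ 2 := by
    rw [← Complex.exp_nat_mul, ← Complex.exp_nat_mul]
    rw [show ((2 : ℕ) : ℂ) * (π * I * (t + 1) / 4) = π / 2 * I + (2 : ℕ) * (π * I * t / 4) by
      push_cast; ring, Complex.exp_add, Complex.exp_pi_div_two_mul_I]
  rw [theta2Sq, theta2Sq, h, mul_pow, mul_pow, h2]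
  ring

theorem etaSq_add_one (t : ℂ) : etaSq (t + 1) = exp (π * I / 6) * etaSq t := by
  have h : ModularForm.eta (t + 1) = exp (π * I / 12) * ModularForm.eta t := by
    rw [ModularForm.eta, ModularForm.eta]
    have h1 : ∀ n, ModularForm.eta_q n (t + 1) = ModularForm.eta_q n t := by
      intro n
      rw [ModularForm.eta_q_eq_pow, ModularForm.eta_q_eq_pow,
        show 2 * π * I * (t + 1) = 2 * π * I * t + 2 * π * I by ring, Complex.exp_periodic]
    simp only [h1]
    rw [Function.Periodic.qParam, Function.Periodic.qParam, ← mul_assoc, ← Complex.exp_add]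
    congr 2
    push_cast
    ring
  rw [etaSq, etaSq, h, mul_pow, ← Complex.exp_nat_mul]
  congr 2
  push_cast
  ring

theorem cpow_half_sq (x : ℂ) : (x ^ (1 / 2 : ℂ)) ^ 2 = x := by
  rw [← Complex.cpow_nat_mul]
  norm_num

/-- Mathlib's functional equation of `jacobiTheta`; squaring removes the choice of square root. -/
theorem theta3Sq_neg_one_div {t : ℂ} (ht : 0 < t.im) :
    theta3Sq (-1 / t) = -I * t * theta3Sq t := by
  have h := jacobiTheta_S_smul ⟨t, ht⟩
  rw [UpperHalfPlane.modular_S_smul] at h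
  have h' : jacobiTheta (-1 / t) = (-I * t) ^ (1 / 2 : ℂ) * jacobiTheta t := by
    rw [← h]
    simp [neg_div, inv_neg]
  rw [theta3Sq, theta3Sq, h', mul_pow, cpow_half_sq]

theorem theta2Sq_neg_one_div {t : ℂ} (ht : 0 < t.im) :
    theta2Sq (-1 / t) = -I * t * theta4Sq t := by
  have ht0 := ne_zero_of_im_pos ht
  have h := jacobiTheta₂_functional_equation (1 / 2) t
  have hneg : jacobiTheta₂ (1 / 2 / t) (-1 / t) = jacobiTheta₂ (-1 / t / 2) (-1 / t) := by
    rw [← jacobiTheta₂_neg_left]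
    congr 1
    ring
  rw [hneg] at h
  have h2 : ((-I * t) ^ (1 / 2 : ℂ)) ≠ 0 := by
    rw [Ne, cpow_eq_zero_iff, not_and_or]
    exact Or.inl (mul_ne_zero (neg_ne_zero.mpr I_ne_zero) ht0)
  rw [theta2Sq, theta4Sq, jacobiTheta_add_one_eq, h,
    show (π : ℂ) * I * (-1 / t) / 4 = -π * I * (1 / 2) ^ 2 / t by ring]
  have h3 := cpow_half_sq (-I * t)
  generalize (-I * t) ^ (1 / 2 : ℂ) = s at h2 h3 ⊢
  rw [← h3]
  field_simp

theorem theta4Sq_neg_one_div {t : ℂ} (ht : 0 < t.im) :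
    theta4Sq (-1 / t) = -I * t * theta2Sq t := by
  have ht0 := ne_zero_of_im_pos ht
  have h := theta2Sq_neg_one_div (neg_one_div_im_pos ht)
  rw [show -1 / (-1 / t) = t by field_simp] at h
  rw [h]
  generalize theta4Sq (-1 / t) = s
  field_simp
  linear_combination s * I_sq

theorem etaSq_neg_one_div {t : ℂ} (ht : 0 < t.im) : etaSq (-1 / t) = -I * t * etaSq t := by
  have ht0 := ne_zero_of_im_pos ht
  have h := ModularForm.eta_comp_eq_csqrt_I_inv ht
  have hs : ∀ x : ℂ, (Complex.sqrt x) ^ 2 = x := fun x => by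
    rw [Complex.sqrt, ← Complex.cpow_nat_mul]; norm_num
  simp only [Function.comp, Pi.smul_apply, Pi.mul_apply, smul_eq_mul] at h
  rw [etaSq, etaSq, h, mul_pow, mul_pow, inv_pow, hs, hs, Complex.inv_I]
  ring

theorem etaSq_ne_zero {t : ℂ} (ht : 0 < t.im) : etaSq t ≠ 0 :=
  pow_ne_zero 2 (ModularForm.eta_ne_zero ht)

theorem differentiableAt_etaSq {t : ℂ} (ht : 0 < t.im) : DifferentiableAt ℂ etaSq t :=
  (ModularForm.differentiableAt_eta_of_mem_upperHalfPlaneSet ht).pow 2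

theorem differentiableAt_theta3Sq {t : ℂ} (ht : 0 < t.im) : DifferentiableAt ℂ theta3Sq t :=
  (differentiableAt_jacobiTheta ht).pow 2

theorem differentiableAt_theta4Sq {t : ℂ} (ht : 0 < t.im) : DifferentiableAt ℂ theta4Sq t := by
  have h : DifferentiableAt ℂ jacobiTheta (t + 1) := differentiableAt_jacobiTheta (by simpa using ht)
  exact (DifferentiableAt.comp t h (by fun_prop : DifferentiableAt ℂ (fun s : ℂ => s + 1) t)).pow 2

theorem differentiableAt_theta2Sq {t : ℂ} (ht : 0 < t.im) : DifferentiableAt ℂ theta2Sq t := by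
  have h : DifferentiableAt ℂ (fun s : ℂ => jacobiTheta₂ (s / 2) s) t :=
    DifferentiableAt.comp t (g := fun p : ℂ × ℂ => jacobiTheta₂ p.1 p.2)
      (f := fun s : ℂ => (s / 2, s)) (hasFDerivAt_jacobiTheta₂ (t / 2) ht).differentiableAt
      (by fun_prop)
  exact (DifferentiableAt.mul (by fun_prop) h).pow 2

/-! ### Behaviour at the cusp -/

theorem norm_exp_pi_mul_I (t : ℂ) : ‖exp (π * I * t)‖ = Real.exp (-π * t.im) := by
  rw [Complex.norm_exp]
  simp

theorem tendsto_exp_cuspInfty : Tendsto (fun t : ℂ => exp (π * I * t)) cuspInfty (𝓝[≠] 0) := by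
  refine tendsto_nhdsWithin_iff.mpr ⟨?_, .of_forall fun t => Complex.exp_ne_zero _⟩
  rw [tendsto_zero_iff_norm_tendsto_zero]
  simp only [norm_exp_pi_mul_I]
  refine Real.tendsto_exp_atBot.comp ?_
  exact tendsto_comap.const_mul_atTop_of_neg (neg_lt_zero.mpr Real.pi_pos)

theorem eventually_im_pos : ∀ᶠ t in cuspInfty, 0 < t.im :=
  tendsto_comap.eventually (eventually_gt_atTop 0)

theorem tendsto_mul_cuspInfty {c : ℝ} (hc : 0 < c) :
    Tendsto (fun t : ℂ => c * t) cuspInfty cuspInfty := by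
  refine tendsto_comap_iff.mpr ?_
  have : (Complex.im ∘ fun t : ℂ => (c : ℂ) * t) = fun t => c * t.im := by
    ext t; simp
  rw [this]
  exact tendsto_comap.const_mul_atTop hc

theorem tendsto_add_cuspInfty (c : ℝ) :
    Tendsto (fun t : ℂ => t + c) cuspInfty cuspInfty := by
  refine tendsto_comap_iff.mpr ?_
  have : (Complex.im ∘ fun t : ℂ => t + (c : ℂ)) = Complex.im := by
    ext t; simp
  rw [this]
  exact tendsto_comap

instance : NeBot cuspInfty :=
  comap_neBot_iff_frequently.mpr <| Frequently.of_forall fun y => ⟨y * I, by simp⟩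

/-- The lacunary power series `∑ q^{aₙ}`. -/
def lacunarySeries (a : ℕ → ℕ) (q : ℂ) : ℂ := ∑' n, q ^ a n

theorem differentiableOn_lacunarySeries {a : ℕ → ℕ} (ha : ∀ n, n ≤ a n) :
    DifferentiableOn ℂ (lacunarySeries a) (Metric.ball 0 (1 / 2)) := by
  refine differentiableOn_tsum_of_summable_norm (u := fun n => (1 / 2 : ℝ) ^ n)
    (summable_geometric_of_lt_one (by norm_num) (by norm_num)) (fun n => by fun_prop)
    Metric.isOpen_ball fun n q hq => ?_
  rw [mem_ball_zero_iff] at hq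
  rw [norm_pow]
  calc ‖q‖ ^ a n ≤ (1 / 2) ^ a n := by gcongr
    _ ≤ (1 / 2) ^ n := pow_le_pow_of_le_one (by norm_num) (by norm_num) (ha n)

theorem lacunarySeries_zero {a : ℕ → ℕ} (ha : ∀ n, n ≤ a n) (h0 : a 0 = 0) :
    lacunarySeries a 0 = 1 := by
  rw [lacunarySeries, tsum_eq_single 0]
  · simp [h0]
  · intro n hn
    exact zero_pow (by have := ha n; omega)

/-- `θ₃²` as a function of `q = e^{πit}`. -/
def theta3SqSeries (q : ℂ) : ℂ := (1 + 2 * (q * lacunarySeries (fun n => n * (n + 2)) q)) ^ 2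

/-- `q^{-1/2} θ₂²` as a function of `q = e^{πit}`. -/
def theta2SqSeries (q : ℂ) : ℂ := 4 * lacunarySeries (fun n => n * (n + 1)) q ^ 2

/-- `q^{-1/6} η²` as a function of `q = e^{πit}`. -/
def etaSqSeries (q : ℂ) : ℂ := (∏' n : ℕ, (1 - (q ^ 2) ^ (n + 1))) ^ 2

theorem theta3Sq_eq_series {t : ℂ} (ht : 0 < t.im) :
    theta3Sq t = theta3SqSeries (exp (π * I * t)) := by
  have h : ∀ n : ℕ, cexp (π * I * ((n : ℂ) + 1) ^ 2 * t)
      = exp (π * I * t) * exp (π * I * t) ^ (n * (n + 2)) := by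
    intro n
    rw [← Complex.exp_nat_mul, ← Complex.exp_add]
    congr 1
    push_cast
    ring
  rw [theta3Sq, theta3SqSeries, jacobiTheta_eq_tsum_nat ht, lacunarySeries, tsum_congr h,
    tsum_mul_left]

theorem theta4Sq_eq_series {t : ℂ} (ht : 0 < t.im) :
    theta4Sq t = theta3SqSeries (-exp (π * I * t)) := by
  rw [← theta3Sq_add_one, theta3Sq_eq_series (by simpa using ht), mul_add, mul_one,
    Complex.exp_add, Complex.exp_pi_mul_I, mul_neg_one]

theorem theta2Sq_eq_series {t : ℂ} (ht : 0 < t.im) :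
    theta2Sq t = exp (π * I * (1 / 2) * t) * theta2SqSeries (exp (π * I * t)) := by
  have hs := hasSum_jacobiTheta₂_term (t / 2) ht
  have h1 : jacobiTheta₂ (t / 2) t
      = 2 * lacunarySeries (fun n => n * (n + 1)) (exp (π * I * t)) := by
    have hterm : ∀ n : ℕ, jacobiTheta₂_term (n : ℤ) (t / 2) t
        = exp (π * I * t) ^ (n * (n + 1)) := by
      intro n
      rw [jacobiTheta₂_term, ← Complex.exp_nat_mul]
      congr 1
      push_cast
      ring
    have hterm' : ∀ n : ℕ, jacobiTheta₂_term (-((n : ℤ) + 1)) (t / 2) t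
        = exp (π * I * t) ^ (n * (n + 1)) := by
      intro n
      rw [jacobiTheta₂_term, ← Complex.exp_nat_mul]
      congr 1
      push_cast
      ring
    have h2 := tsum_of_nat_of_neg_add_one (f := fun n : ℤ => jacobiTheta₂_term n (t / 2) t)
      (hs.summable.comp_injective Nat.cast_injective)
      (hs.summable.comp_injective (i := fun n : ℕ => -((n : ℤ) + 1))
        (fun a b h => by simpa using h))
    rw [jacobiTheta₂, h2]
    simp only [hterm, hterm', lacunarySeries]
    ring
  rw [theta2Sq, h1, theta2SqSeries, mul_pow, ← Complex.exp_nat_mul]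
  rw [show ((2 : ℕ) : ℂ) * (π * I * t / 4) = π * I * (1 / 2) * t by push_cast; ring]
  ring

theorem etaSq_eq_series (t : ℂ) :
    etaSq t = exp (π * I * (1 / 6) * t) * etaSqSeries (exp (π * I * t)) := by
  have h : ∀ n, ModularForm.eta_q n t = (exp (π * I * t) ^ 2) ^ (n + 1) := by
    intro n
    rw [ModularForm.eta_q_eq_pow, ← Complex.exp_nat_mul (π * I * t)]
    congr 2
    push_cast
    ring
  rw [etaSq, etaSqSeries, ModularForm.eta, mul_pow]
  simp only [h]
  rw [Function.Periodic.qParam, ← Complex.exp_nat_mul]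
  congr 2
  push_cast
  ring

theorem differentiableOn_theta3SqSeries :
    DifferentiableOn ℂ theta3SqSeries (Metric.ball 0 (1 / 2)) := by
  have h := differentiableOn_lacunarySeries (a := fun n => n * (n + 2)) fun n => by nlinarith
  unfold theta3SqSeries
  fun_prop

theorem differentiableOn_theta2SqSeries :
    DifferentiableOn ℂ theta2SqSeries (Metric.ball 0 (1 / 2)) := by
  have h := differentiableOn_lacunarySeries (a := fun n => n * (n + 1)) fun n => by nlinarith
  unfold theta2SqSeries
  fun_prop

theorem differentiableOn_etaSqSeries :
    DifferentiableOn ℂ etaSqSeries (Metric.ball 0 (1 / 2)) := by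
  refine DifferentiableOn.pow (DifferentiableOn.comp
    ModularForm.differentiableOn_tprod_one_sub_pow (by fun_prop) fun q hq => ?_) 2
  rw [mem_ball_zero_iff] at hq ⊢
  rw [norm_pow]
  nlinarith [norm_nonneg q]

@[simp]
theorem theta3SqSeries_zero : theta3SqSeries 0 = 1 := by simp [theta3SqSeries]

@[simp]
theorem theta2SqSeries_zero : theta2SqSeries 0 = 4 := by
  simp [theta2SqSeries,
    lacunarySeries_zero (a := fun n => n * (n + 1)) (fun n => by nlinarith) (by simp)]

@[simp]
theorem etaSqSeries_zero : etaSqSeries 0 = 1 := by simp [etaSqSeries]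

theorem ball_half_mem_nhds : Metric.ball (0 : ℂ) (1 / 2) ∈ 𝓝 0 :=
  Metric.ball_mem_nhds 0 (by norm_num)

/-- `θ₃² = 1 + 4q + ⋯`. -/
theorem hasDerivAt_theta3SqSeries : HasDerivAt theta3SqSeries 4 0 := by
  have h := ((differentiableOn_lacunarySeries (a := fun n => n * (n + 2))
    fun n => by nlinarith).differentiableAt ball_half_mem_nhds).hasDerivAt
  have h2 := ((((hasDerivAt_id (0 : ℂ)).mul h).const_mul 2).const_add 1).pow 2
  refine h2.congr_deriv ?_
  simp [lacunarySeries_zero (a := fun n => n * (n + 2)) (fun n => by nlinarith) (by simp)]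
  norm_num

/-- If `F` is holomorphic at `0`, then `F(q) → F(0)` at the cusp. -/
theorem tendsto_series {F : ℂ → ℂ} (hF : DifferentiableOn ℂ F (Metric.ball 0 (1 / 2))) :
    Tendsto (fun t : ℂ => F (exp (π * I * t))) cuspInfty (𝓝 (F 0)) :=
  (hF.differentiableAt ball_half_mem_nhds).continuousAt.tendsto.comp
    (tendsto_nhdsWithin_iff.mp tendsto_exp_cuspInfty).1

theorem tendsto_exp_mul_cuspInfty {c : ℝ} (hc : 0 < c) :
    Tendsto (fun t : ℂ => exp (π * I * c * t)) cuspInfty (𝓝 0) := by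
  have h := (tendsto_nhdsWithin_iff.mp tendsto_exp_cuspInfty).1.comp (tendsto_mul_cuspInfty hc)
  refine h.congr fun t => ?_
  simp only [Function.comp]
  ring_nf

theorem tendsto_theta3Sq : Tendsto theta3Sq cuspInfty (𝓝 1) := by
  have h := tendsto_series differentiableOn_theta3SqSeries
  rw [theta3SqSeries_zero] at h
  refine h.congr' ?_
  filter_upwards [eventually_im_pos] with t ht using (theta3Sq_eq_series ht).symm

theorem tendsto_theta4Sq : Tendsto theta4Sq cuspInfty (𝓝 1) := by
  have h := tendsto_theta3Sq.comp (tendsto_add_cuspInfty 1)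
  refine h.congr fun t => ?_
  simp [theta3Sq_add_one]

theorem tendsto_theta2Sq : Tendsto theta2Sq cuspInfty (𝓝 0) := by
  have h := (tendsto_exp_mul_cuspInfty (c := 1 / 2) (by norm_num)).mul
    (tendsto_series differentiableOn_theta2SqSeries)
  rw [zero_mul] at h
  refine h.congr' ?_
  filter_upwards [eventually_im_pos] with t ht
  rw [theta2Sq_eq_series ht]
  push_cast
  rfl

theorem tendsto_etaSq : Tendsto etaSq cuspInfty (𝓝 0) := by
  have h := (tendsto_exp_mul_cuspInfty (c := 1 / 6) (by norm_num)).mul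
    (tendsto_series differentiableOn_etaSqSeries)
  rw [zero_mul] at h
  refine h.congr fun t => ?_
  rw [etaSq_eq_series t]
  push_cast
  rfl

/-- The logarithmic derivative of `e^{πict} F(q)` with `F(0) ≠ 0` tends to `πic` at the cusp. -/
theorem tendsto_logDeriv_series {f F : ℂ → ℂ} {c : ℂ}
    (hF : DifferentiableOn ℂ F (Metric.ball 0 (1 / 2))) (hF0 : F 0 ≠ 0)
    (hf : ∀ t : ℂ, 0 < t.im → f t = exp (π * I * c * t) * F (exp (π * I * t))) :
    Tendsto (logDeriv f) cuspInfty (𝓝 (π * I * c)) := by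
  have hq := (tendsto_nhdsWithin_iff.mp tendsto_exp_cuspInfty).1
  have hF' : ContinuousAt (deriv F) 0 :=
    ((hF.deriv Metric.isOpen_ball).differentiableAt ball_half_mem_nhds).continuousAt
  have h1 := hF'.tendsto.comp hq
  have h2 := tendsto_series hF
  have h3 := (((hq.const_mul (π * I : ℂ)).mul h1).div h2 hF0).const_add (π * I * c : ℂ)
  rw [mul_zero, zero_mul, zero_div, add_zero] at h3
  refine h3.congr' ?_
  filter_upwards [eventually_im_pos, hq.eventually (Metric.isOpen_ball.mem_nhds
    (Metric.mem_ball_self (by norm_num : (0 : ℝ) < 1 / 2))), h2.eventually_ne hF0] with t ht htb hne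
  have hev : f =ᶠ[𝓝 t] fun s => exp (π * I * c * s) * F (exp (π * I * s)) := by
    filter_upwards [(isOpen_lt continuous_const Complex.continuous_im).mem_nhds ht] with s hs
      using hf s hs
  have hd1 : HasDerivAt (fun s : ℂ => exp (π * I * c * s)) (exp (π * I * c * t) * (π * I * c)) t := by
    simpa using ((hasDerivAt_id t).const_mul (π * I * c : ℂ)).cexp
  have hd2 : HasDerivAt (fun s : ℂ => exp (π * I * s)) (exp (π * I * t) * (π * I)) t := by
    simpa using ((hasDerivAt_id t).const_mul (π * I : ℂ)).cexp
  have hd3 : HasDerivAt (fun s : ℂ => F (exp (π * I * s)))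
      (deriv F (exp (π * I * t)) * (exp (π * I * t) * (π * I))) t :=
    HasDerivAt.comp t ((hF.differentiableAt (Metric.isOpen_ball.mem_nhds htb)).hasDerivAt) hd2
  have hexp := Complex.exp_ne_zero (π * I * c * t)
  rw [logDeriv_apply, hev.deriv_eq, (hd1.fun_mul hd3).deriv, hf t ht]
  simp only [Function.comp, Pi.div_apply]
  field_simp

theorem tendsto_logDeriv_theta3Sq : Tendsto (logDeriv theta3Sq) cuspInfty (𝓝 0) := by
  have := tendsto_logDeriv_series (c := 0) differentiableOn_theta3SqSeries (by simp)
    (f := theta3Sq) fun t ht => by simp [theta3Sq_eq_series ht]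
  simpa using this

theorem tendsto_logDeriv_theta4Sq : Tendsto (logDeriv theta4Sq) cuspInfty (𝓝 0) := by
  have hd : DifferentiableOn ℂ (fun q => theta3SqSeries (-q)) (Metric.ball 0 (1 / 2)) :=
    differentiableOn_theta3SqSeries.comp (by fun_prop) fun q hq => by simpa using hq
  have := tendsto_logDeriv_series (c := 0) hd (by simp)
    (f := theta4Sq) fun t ht => by simp [theta4Sq_eq_series ht]
  simpa using this

theorem tendsto_logDeriv_theta2Sq :
    Tendsto (logDeriv theta2Sq) cuspInfty (𝓝 (π * I * (1 / 2))) :=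
  tendsto_logDeriv_series differentiableOn_theta2SqSeries (by simp)
    fun _ ht => theta2Sq_eq_series ht

theorem tendsto_logDeriv_etaSq :
    Tendsto (logDeriv etaSq) cuspInfty (𝓝 (π * I * (1 / 6))) :=
  tendsto_logDeriv_series differentiableOn_etaSqSeries (by simp)
    fun t _ => etaSq_eq_series t

/-! ### Classical identities at level one -/

theorem isOpen_upper : IsOpen {t : ℂ | 0 < t.im} := isOpen_lt continuous_const Complex.continuous_im

/-- `θ₂θ₃θ₄ = 2η³`, squared. -/
theorem theta_mul_theta_mul_theta {t : ℂ} (ht : 0 < t.im) :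
    theta2Sq t * theta3Sq t * theta4Sq t = 4 * etaSq t ^ 3 := by
  have hexp : exp (π * I / 6) ^ 3 = I := by
    rw [← Complex.exp_nat_mul,
      show ((3 : ℕ) : ℂ) * (π * I / 6) = π / 2 * I by push_cast; ring,
      Complex.exp_pi_div_two_mul_I]
  have h := eq_zero_of_levelOne (k := 0) (by norm_num)
    (f := fun t => theta2Sq t * theta3Sq t * theta4Sq t / etaSq t ^ 3 - 4) ?_ ?_ ?_ ?_ ht
  · have h0 := etaSq_ne_zero ht
    rw [sub_eq_zero, div_eq_iff (pow_ne_zero 3 h0)] at h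
    exact h
  · intro s hs
    exact (((((differentiableAt_theta2Sq hs).mul (differentiableAt_theta3Sq hs)).mul
      (differentiableAt_theta4Sq hs)).div ((differentiableAt_etaSq hs).pow 3)
      (pow_ne_zero 3 (etaSq_ne_zero hs))).sub_const 4).differentiableWithinAt
  · intro s hs
    have h0 := etaSq_ne_zero hs
    rw [theta2Sq_add_one, theta3Sq_add_one, theta4Sq_add_one, etaSq_add_one, mul_pow, hexp]
    have := I_ne_zero
    field_simp
  · intro s hs
    have h0 := etaSq_ne_zero hs
    have hs0 := ne_zero_of_im_pos hs
    rw [theta2Sq_neg_one_div hs, theta3Sq_neg_one_div hs, theta4Sq_neg_one_div hs,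
      etaSq_neg_one_div hs]
    have := I_ne_zero
    field_simp
  · have hd4 : DifferentiableOn ℂ (fun q => theta3SqSeries (-q)) (Metric.ball 0 (1 / 2)) :=
      differentiableOn_theta3SqSeries.comp (by fun_prop) fun q hq => by simpa using hq
    have h := ((((tendsto_series differentiableOn_theta2SqSeries).mul
      (tendsto_series differentiableOn_theta3SqSeries)).mul (tendsto_series hd4)).div
      ((tendsto_series differentiableOn_etaSqSeries).pow 3) (by simp)).sub_const 4
    simp only [theta2SqSeries_zero, theta3SqSeries_zero, etaSqSeries_zero, neg_zero, mul_one,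
      one_pow, div_one, sub_self] at h
    refine h.congr' ?_
    filter_upwards [eventually_im_pos] with t ht
    have he : exp (π * I * (1 / 6) * t) ^ 3 = exp (π * I * (1 / 2) * t) := by
      rw [← Complex.exp_nat_mul]
      congr 1
      push_cast
      ring
    rw [theta2Sq_eq_series ht, theta3Sq_eq_series ht, theta4Sq_eq_series ht, etaSq_eq_series,
      mul_pow, he]
    have := Complex.exp_ne_zero (π * I * (1 / 2) * t)
    simp only [Pi.div_apply]
    congr 1
    rw [mul_assoc (exp _), mul_assoc (exp _), mul_div_mul_left _ _ this]

theorem theta2Sq_ne_zero {t : ℂ} (ht : 0 < t.im) : theta2Sq t ≠ 0 := by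
  intro h
  have := theta_mul_theta_mul_theta ht
  simp [h, etaSq_ne_zero ht] at this

theorem theta3Sq_ne_zero {t : ℂ} (ht : 0 < t.im) : theta3Sq t ≠ 0 := by
  intro h
  have := theta_mul_theta_mul_theta ht
  simp [h, etaSq_ne_zero ht] at this

theorem theta4Sq_ne_zero {t : ℂ} (ht : 0 < t.im) : theta4Sq t ≠ 0 := by
  intro h
  have := theta_mul_theta_mul_theta ht
  simp [h, etaSq_ne_zero ht] at this

/-- Jacobi's identity `θ₃⁴ = θ₂⁴ + θ₄⁴`. The difference changes sign under both generators of
`SL₂(ℤ)`, so its square has level one. -/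
theorem jacobi_identity {t : ℂ} (ht : 0 < t.im) :
    theta3Sq t ^ 2 = theta2Sq t ^ 2 + theta4Sq t ^ 2 := by
  have h := eq_zero_of_levelOne (k := 4) (by norm_num)
    (f := fun t => (theta3Sq t ^ 2 - theta2Sq t ^ 2 - theta4Sq t ^ 2) ^ 2) ?_ ?_ ?_ ?_ ht
  · have := pow_eq_zero_iff (two_ne_zero) |>.mp h
    linear_combination this
  · intro s hs
    have h2 := differentiableAt_theta2Sq hs
    have h3 := differentiableAt_theta3Sq hs
    have h4 := differentiableAt_theta4Sq hs
    exact DifferentiableAt.differentiableWithinAt (by fun_prop)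
  · intro s hs
    rw [theta2Sq_add_one, theta3Sq_add_one, theta4Sq_add_one, mul_pow, I_sq]
    ring
  · intro s hs
    rw [theta2Sq_neg_one_div hs, theta3Sq_neg_one_div hs, theta4Sq_neg_one_div hs]
    simp only [mul_pow, neg_sq, I_sq]
    ring
  · have h := (((tendsto_theta3Sq.pow 2).sub (tendsto_theta2Sq.pow 2)).sub
      (tendsto_theta4Sq.pow 2)).pow 2
    simpa using h

theorem differentiableAt_logDeriv {f : ℂ → ℂ} (hf : ∀ t : ℂ, 0 < t.im → DifferentiableAt ℂ f t)
    (h0 : ∀ t : ℂ, 0 < t.im → f t ≠ 0) {t : ℂ} (ht : 0 < t.im) :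
    DifferentiableAt ℂ (logDeriv f) t := by
  have hd : DifferentiableOn ℂ f {t : ℂ | 0 < t.im} := fun s hs => (hf s hs).differentiableWithinAt
  exact ((hd.deriv isOpen_upper).differentiableAt (isOpen_upper.mem_nhds ht)).div (hf t ht) (h0 t ht)

theorem logDeriv_add_one {f g : ℂ → ℂ} {c : ℂ} (hc : c ≠ 0)
    (h : ∀ t, f (t + 1) = c * g t) (t : ℂ) : logDeriv f (t + 1) = logDeriv g t := by
  have h1 : deriv f (t + 1) = c * deriv g t := by
    rw [← deriv_comp_add_const, funext h, deriv_const_mul_field]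
  rw [logDeriv_apply, logDeriv_apply, h1, h t, mul_div_mul_left _ _ hc]

/-- The logarithmic derivative of the weight-one law `f(-1/t) = -it g(t)`. -/
theorem logDeriv_neg_one_div {f g : ℂ → ℂ}
    (hf : ∀ t : ℂ, 0 < t.im → DifferentiableAt ℂ f t)
    (hg : ∀ t : ℂ, 0 < t.im → DifferentiableAt ℂ g t)
    (hg0 : ∀ t : ℂ, 0 < t.im → g t ≠ 0)
    (h : ∀ t : ℂ, 0 < t.im → f (-1 / t) = -I * t * g t) {t : ℂ} (ht : 0 < t.im) :
    logDeriv f (-1 / t) = t ^ 2 * logDeriv g t + t := by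
  have ht0 := ne_zero_of_im_pos ht
  have hinv : HasDerivAt (fun s : ℂ => -1 / s) (1 / t ^ 2) t := by
    have := (hasDerivAt_inv ht0).const_mul (-1)
    refine (this.congr_deriv ?_).congr_of_eventuallyEq (.of_forall fun s => ?_)
    · ring
    · simp [div_eq_mul_inv]
  have h1 : HasDerivAt (fun s => f (-1 / s)) (deriv f (-1 / t) * (1 / t ^ 2)) t :=
    HasDerivAt.comp t (hf _ (neg_one_div_im_pos ht)).hasDerivAt hinv
  have h2 : HasDerivAt (fun s => -I * s * g s) (-I * g t + -I * t * deriv g t) t := by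
    simpa using ((hasDerivAt_id t).const_mul (-I)).fun_mul (hg t ht).hasDerivAt
  have h3 : HasDerivAt (fun s => f (-1 / s)) (-I * g t + -I * t * deriv g t) t :=
    h2.congr_of_eventuallyEq <| by
      filter_upwards [isOpen_upper.mem_nhds ht] with s hs using h s hs
  have h4 := h1.unique h3
  have h5 : deriv f (-1 / t) = t ^ 2 * (-I * g t + -I * t * deriv g t) := by
    rw [← h4]
    field_simp
  have hI := I_ne_zero
  have := hg0 t ht
  rw [logDeriv_apply, logDeriv_apply, h5, h t ht]
  field_simp
  ring

/-- The logarithmic derivatives of the theta constants. The three differences between the two sides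
have weight two and are permuted by `SL₂(ℤ)` and their sum is zero, so the two other elementary
symmetric functions are level-one forms, of weights four and six, which vanish at the cusp. -/
theorem logDeriv_theta {t : ℂ} (ht : 0 < t.im) :
    logDeriv theta2Sq t = logDeriv etaSq t + π * I / 6 * (theta4Sq t ^ 2 + theta3Sq t ^ 2) ∧
    logDeriv theta3Sq t = logDeriv etaSq t + π * I / 6 * (theta2Sq t ^ 2 - theta4Sq t ^ 2) ∧
    logDeriv theta4Sq t = logDeriv etaSq t - π * I / 6 * (theta2Sq t ^ 2 + theta3Sq t ^ 2) := by
  set h2 : ℂ → ℂ := fun t => logDeriv theta2Sq t - logDeriv etaSq t -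
    π * I / 6 * (theta4Sq t ^ 2 + theta3Sq t ^ 2) with hh2
  set h3 : ℂ → ℂ := fun t => logDeriv theta3Sq t - logDeriv etaSq t -
    π * I / 6 * (theta2Sq t ^ 2 - theta4Sq t ^ 2) with hh3
  set h4 : ℂ → ℂ := fun t => logDeriv theta4Sq t - logDeriv etaSq t +
    π * I / 6 * (theta2Sq t ^ 2 + theta3Sq t ^ 2) with hh4
  have hTeta := logDeriv_add_one (Complex.exp_ne_zero _) etaSq_add_one
  have hT2 := logDeriv_add_one I_ne_zero theta2Sq_add_one
  have hT3 := logDeriv_add_one (f := theta3Sq) (g := theta4Sq) one_ne_zero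
    (fun t => by rw [theta3Sq_add_one, one_mul])
  have hT4 := logDeriv_add_one (f := theta4Sq) (g := theta3Sq) one_ne_zero
    (fun t => by rw [theta4Sq_add_one, one_mul])
  have T2 : ∀ s, h2 (s + 1) = h2 s := by
    intro s
    simp only [hh2, hTeta, hT2, theta3Sq_add_one, theta4Sq_add_one]
    ring
  have T3 : ∀ s, h3 (s + 1) = h4 s := by
    intro s
    simp only [hh3, hh4, hTeta, hT3, theta2Sq_add_one, theta4Sq_add_one, mul_pow, I_sq]
    ring
  have T4 : ∀ s, h4 (s + 1) = h3 s := by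
    intro s
    simp only [hh3, hh4, hTeta, hT4, theta2Sq_add_one, theta3Sq_add_one, mul_pow, I_sq]
    ring
  have hSeta := fun (s : ℂ) (hs : 0 < s.im) => logDeriv_neg_one_div
    (fun _ h => differentiableAt_etaSq h) (fun _ h => differentiableAt_etaSq h)
    (fun _ h => etaSq_ne_zero h) (fun _ h => etaSq_neg_one_div h) hs
  have hS2 := fun (s : ℂ) (hs : 0 < s.im) => logDeriv_neg_one_div
    (fun _ h => differentiableAt_theta2Sq h) (fun _ h => differentiableAt_theta4Sq h)
    (fun _ h => theta4Sq_ne_zero h) (fun _ h => theta2Sq_neg_one_div h) hs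
  have hS3 := fun (s : ℂ) (hs : 0 < s.im) => logDeriv_neg_one_div
    (fun _ h => differentiableAt_theta3Sq h) (fun _ h => differentiableAt_theta3Sq h)
    (fun _ h => theta3Sq_ne_zero h) (fun _ h => theta3Sq_neg_one_div h) hs
  have hS4 := fun (s : ℂ) (hs : 0 < s.im) => logDeriv_neg_one_div
    (fun _ h => differentiableAt_theta4Sq h) (fun _ h => differentiableAt_theta2Sq h)
    (fun _ h => theta2Sq_ne_zero h) (fun _ h => theta4Sq_neg_one_div h) hs
  have S2 : ∀ s : ℂ, 0 < s.im → h2 (-1 / s) = s ^ 2 * h4 s := by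
    intro s hs
    simp only [hh2, hh4, hSeta s hs, hS2 s hs, theta3Sq_neg_one_div hs, theta4Sq_neg_one_div hs,
      mul_pow, neg_sq, I_sq]
    ring
  have S3 : ∀ s : ℂ, 0 < s.im → h3 (-1 / s) = s ^ 2 * h3 s := by
    intro s hs
    simp only [hh3, hSeta s hs, hS3 s hs, theta2Sq_neg_one_div hs, theta4Sq_neg_one_div hs,
      mul_pow, neg_sq, I_sq]
    ring
  have S4 : ∀ s : ℂ, 0 < s.im → h4 (-1 / s) = s ^ 2 * h2 s := by
    intro s hs
    simp only [hh2, hh4, hSeta s hs, hS4 s hs, theta2Sq_neg_one_div hs, theta3Sq_neg_one_div hs,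
      mul_pow, neg_sq, I_sq]
    ring
  have hdθ2 := fun (s : ℂ) (hs : 0 < s.im) => differentiableAt_theta2Sq hs
  have hdθ3 := fun (s : ℂ) (hs : 0 < s.im) => differentiableAt_theta3Sq hs
  have hdθ4 := fun (s : ℂ) (hs : 0 < s.im) => differentiableAt_theta4Sq hs
  have hdη := fun (s : ℂ) (hs : 0 < s.im) => differentiableAt_logDeriv
    (fun _ h => differentiableAt_etaSq h) (fun _ h => etaSq_ne_zero h) hs
  have d2 : ∀ s : ℂ, 0 < s.im → DifferentiableAt ℂ h2 s := fun s hs =>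
    ((differentiableAt_logDeriv hdθ2 (fun _ h => theta2Sq_ne_zero h) hs).sub (hdη s hs)).sub
      ((((hdθ4 s hs).pow 2).add ((hdθ3 s hs).pow 2)).const_mul _)
  have d3 : ∀ s : ℂ, 0 < s.im → DifferentiableAt ℂ h3 s := fun s hs =>
    ((differentiableAt_logDeriv hdθ3 (fun _ h => theta3Sq_ne_zero h) hs).sub (hdη s hs)).sub
      ((((hdθ2 s hs).pow 2).sub ((hdθ4 s hs).pow 2)).const_mul _)
  have d4 : ∀ s : ℂ, 0 < s.im → DifferentiableAt ℂ h4 s := fun s hs =>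
    ((differentiableAt_logDeriv hdθ4 (fun _ h => theta4Sq_ne_zero h) hs).sub (hdη s hs)).add
      ((((hdθ2 s hs).pow 2).add ((hdθ3 s hs).pow 2)).const_mul _)
  have l2 : Tendsto h2 cuspInfty (𝓝 0) := by
    have := (tendsto_logDeriv_theta2Sq.sub tendsto_logDeriv_etaSq).sub
      (((tendsto_theta4Sq.pow 2).add (tendsto_theta3Sq.pow 2)).const_mul (π * I / 6 : ℂ))
    convert! this using 2
    ring
  have l3 : Tendsto h3 cuspInfty (𝓝 0) := by
    have := (tendsto_logDeriv_theta3Sq.sub tendsto_logDeriv_etaSq).sub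
      (((tendsto_theta2Sq.pow 2).sub (tendsto_theta4Sq.pow 2)).const_mul (π * I / 6 : ℂ))
    convert! this using 2
    ring
  have l4 : Tendsto h4 cuspInfty (𝓝 0) := by
    have := (tendsto_logDeriv_theta4Sq.sub tendsto_logDeriv_etaSq).add
      (((tendsto_theta2Sq.pow 2).add (tendsto_theta3Sq.pow 2)).const_mul (π * I / 6 : ℂ))
    convert! this using 2
    ring
  -- The sum vanishes by logarithmic differentiation of `θ₂²θ₃²θ₄² = 4η⁶`.
  have e1 : h2 t + h3 t + h4 t = 0 := by
    have hev : (fun s => theta2Sq s * theta3Sq s * theta4Sq s) =ᶠ[𝓝 t] fun s => 4 * etaSq s ^ 3 := by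
      filter_upwards [isOpen_upper.mem_nhds ht] with s hs using theta_mul_theta_mul_theta hs
    have hl : logDeriv (fun s => theta2Sq s * theta3Sq s * theta4Sq s) t
        = logDeriv (fun s => 4 * etaSq s ^ 3) t := by
      rw [logDeriv_apply, logDeriv_apply, hev.deriv_eq, hev.eq_of_nhds]
    rw [logDeriv_mul (f := fun s => theta2Sq s * theta3Sq s) (g := theta4Sq) t
        (mul_ne_zero (theta2Sq_ne_zero ht) (theta3Sq_ne_zero ht)) (theta4Sq_ne_zero ht)
        ((hdθ2 t ht).mul (hdθ3 t ht)) (hdθ4 t ht),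
      logDeriv_mul t (theta2Sq_ne_zero ht) (theta3Sq_ne_zero ht) (hdθ2 t ht) (hdθ3 t ht),
      logDeriv_const_mul t _ (by norm_num : (4 : ℂ) ≠ 0),
      logDeriv_fun_pow (differentiableAt_etaSq ht)] at hl
    simp only [hh2, hh3, hh4]
    push_cast at hl
    linear_combination hl
  have e2 : h2 t * h3 t + h3 t * h4 t + h4 t * h2 t = 0 := by
    refine eq_zero_of_levelOne (k := 4) (by norm_num)
      (f := fun t => h2 t * h3 t + h3 t * h4 t + h4 t * h2 t) ?_ ?_ ?_ ?_ ht
    · exact fun s hs => ((((d2 s hs).mul (d3 s hs)).add ((d3 s hs).mul (d4 s hs))).add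
        ((d4 s hs).mul (d2 s hs))).differentiableWithinAt
    · intro s hs
      simp only [T2, T3, T4]
      ring
    · intro s hs
      simp only [S2 s hs, S3 s hs, S4 s hs]
      ring
    · simpa using ((l2.mul l3).add (l3.mul l4)).add (l4.mul l2)
  have e3 : h2 t * h3 t * h4 t = 0 := by
    refine eq_zero_of_levelOne (k := 6) (by norm_num)
      (f := fun t => h2 t * h3 t * h4 t) ?_ ?_ ?_ ?_ ht
    · exact fun s hs => (((d2 s hs).mul (d3 s hs)).mul (d4 s hs)).differentiableWithinAt
    · intro s hs
      simp only [T2, T3, T4]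
      ring
    · intro s hs
      simp only [S2 s hs, S3 s hs, S4 s hs]
      ring
    · simpa using (l2.mul l3).mul l4
  have key : ∀ x, (x - h2 t) * (x - h3 t) * (x - h4 t) = x ^ 3 := by
    intro x
    linear_combination -x ^ 2 * e1 + x * e2 - e3
  have k2 : h2 t = 0 := by
    have := key (h2 t)
    rw [sub_self, zero_mul, zero_mul] at this
    exact pow_eq_zero_iff (three_ne_zero) |>.mp this.symm
  have k3 : h3 t = 0 := by
    have := key (h3 t)
    rw [sub_self, mul_zero, zero_mul] at this
    exact pow_eq_zero_iff (three_ne_zero) |>.mp this.symm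
  have k4 : h4 t = 0 := by
    have := key (h4 t)
    rw [sub_self, mul_zero] at this
    exact pow_eq_zero_iff (three_ne_zero) |>.mp this.symm
  simp only [hh2, hh3, hh4] at k2 k3 k4
  refine ⟨?_, ?_, ?_⟩
  · linear_combination k2
  · linear_combination k3
  · linear_combination k4

/-! ### Logarithmic derivatives and Ramanujan's equation -/

/-- `D log η²`, where `D = (πi)⁻¹ d/dt`; this is `E₂/6`. -/
def dlogEtaSq (t : ℂ) : ℂ := logDeriv etaSq t / (π * I)

theorem pi_mul_I_ne_zero : (π * I : ℂ) ≠ 0 :=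
  mul_ne_zero (by exact_mod_cast Real.pi_ne_zero) I_ne_zero

theorem hasDerivAt_etaSq {t : ℂ} (ht : 0 < t.im) :
    HasDerivAt etaSq (π * I * (etaSq t * dlogEtaSq t)) t := by
  refine (differentiableAt_etaSq ht).hasDerivAt.congr_deriv ?_
  have := pi_mul_I_ne_zero
  have := etaSq_ne_zero ht
  rw [dlogEtaSq, logDeriv_apply]
  field_simp

theorem hasDerivAt_of_logDeriv {f : ℂ → ℂ} {t a : ℂ} (hf : DifferentiableAt ℂ f t) (h0 : f t ≠ 0)
    (h : logDeriv f t = logDeriv etaSq t + π * I * a) :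
    HasDerivAt f (π * I * (f t * (dlogEtaSq t + a))) t := by
  refine hf.hasDerivAt.congr_deriv ?_
  have := pi_mul_I_ne_zero
  rw [logDeriv_apply, div_eq_iff h0] at h
  rw [h, dlogEtaSq]
  field_simp

theorem hasDerivAt_theta2Sq {t : ℂ} (ht : 0 < t.im) :
    HasDerivAt theta2Sq
      (π * I * (theta2Sq t * (dlogEtaSq t + (theta4Sq t ^ 2 + theta3Sq t ^ 2) / 6))) t :=
  hasDerivAt_of_logDeriv (differentiableAt_theta2Sq ht) (theta2Sq_ne_zero ht) <| by
    rw [(logDeriv_theta ht).1]; ring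

theorem hasDerivAt_theta3Sq {t : ℂ} (ht : 0 < t.im) :
    HasDerivAt theta3Sq
      (π * I * (theta3Sq t * (dlogEtaSq t + (theta2Sq t ^ 2 - theta4Sq t ^ 2) / 6))) t :=
  hasDerivAt_of_logDeriv (differentiableAt_theta3Sq ht) (theta3Sq_ne_zero ht) <| by
    rw [(logDeriv_theta ht).2.1]; ring

theorem hasDerivAt_theta4Sq {t : ℂ} (ht : 0 < t.im) :
    HasDerivAt theta4Sq
      (π * I * (theta4Sq t * (dlogEtaSq t + -(theta2Sq t ^ 2 + theta3Sq t ^ 2) / 6))) t :=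
  hasDerivAt_of_logDeriv (differentiableAt_theta4Sq ht) (theta4Sq_ne_zero ht) <| by
    rw [(logDeriv_theta ht).2.2]; ring

theorem differentiableAt_dlogEtaSq {t : ℂ} (ht : 0 < t.im) : DifferentiableAt ℂ dlogEtaSq t :=
  (differentiableAt_logDeriv (fun _ h => differentiableAt_etaSq h)
    (fun _ h => etaSq_ne_zero h) ht).div_const _

/-- Cauchy's estimate: the derivative of a holomorphic function with a limit at the cusp tends to
zero there. -/
theorem tendsto_deriv_cuspInfty {f : ℂ → ℂ} {a : ℂ}
    (hf : ∀ t : ℂ, 0 < t.im → DifferentiableAt ℂ f t) (h : Tendsto f cuspInfty (𝓝 a)) :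
    Tendsto (deriv f) cuspInfty (𝓝 0) := by
  rw [Metric.tendsto_nhds] at h ⊢
  intro ε hε
  have h1 := h (ε / 2) (half_pos hε)
  rw [eventually_comap, eventually_atTop] at h1
  obtain ⟨M, hM⟩ := h1
  have h2 : ∀ᶠ t in cuspInfty, max M 0 + 1 < t.im :=
    tendsto_comap.eventually (eventually_gt_atTop _)
  filter_upwards [h2] with t ht
  have him : ∀ s ∈ Metric.closedBall t 1, max M 0 < s.im := by
    intro s hs
    rw [Metric.mem_closedBall, dist_eq_norm] at hs
    have := (abs_le.mp ((Complex.abs_im_le_norm (s - t)).trans hs)).1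
    rw [Complex.sub_im] at this
    linarith
  have hle : ‖deriv (fun s => f s - a) t‖ ≤ ε / 2 / 1 := by
    refine Complex.norm_deriv_le_of_forall_mem_sphere_norm_le one_pos ?_ ?_
    · refine DifferentiableOn.diffContOnCl_ball (U := {t : ℂ | 0 < t.im})
        (fun s hs => ((hf s hs).sub_const a).differentiableWithinAt) fun s hs => ?_
      exact lt_of_le_of_lt (le_max_right M 0) (him s hs)
    · intro s hs
      have h3 := him s (Metric.sphere_subset_closedBall hs)
      have := hM s.im ((le_max_left M 0).trans h3.le) s rfl
      rw [dist_eq_norm] at this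
      exact this.le
  rw [deriv_sub_const] at hle
  rw [dist_zero_right]
  linarith

theorem tendsto_dlogEtaSq : Tendsto dlogEtaSq cuspInfty (𝓝 (1 / 6)) := by
  have := tendsto_logDeriv_etaSq.div_const (π * I)
  rwa [mul_div_cancel_left₀ _ pi_mul_I_ne_zero] at this

theorem dlogEtaSq_add_one (t : ℂ) : dlogEtaSq (t + 1) = dlogEtaSq t := by
  rw [dlogEtaSq, dlogEtaSq, logDeriv_add_one (Complex.exp_ne_zero _) etaSq_add_one]

theorem dlogEtaSq_neg_one_div {t : ℂ} (ht : 0 < t.im) :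
    dlogEtaSq (-1 / t) = t ^ 2 * dlogEtaSq t + t / (π * I) := by
  rw [dlogEtaSq, logDeriv_neg_one_div (fun _ h => differentiableAt_etaSq h)
    (fun _ h => differentiableAt_etaSq h) (fun _ h => etaSq_ne_zero h)
    (fun _ h => etaSq_neg_one_div h) ht, dlogEtaSq]
  ring

/-- Ramanujan's differential equation for `E₂`, with `E₄ = (θ₂⁸ + θ₃⁸ + θ₄⁸)/2`. -/
theorem hasDerivAt_dlogEtaSq {t : ℂ} (ht : 0 < t.im) :
    HasDerivAt dlogEtaSq (π * I * (dlogEtaSq t ^ 2 -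
      (theta2Sq t ^ 4 + theta3Sq t ^ 4 + theta4Sq t ^ 4) / 72)) t := by
  refine (differentiableAt_dlogEtaSq ht).hasDerivAt.congr_deriv ?_
  have hpi := pi_mul_I_ne_zero
  have h := eq_zero_of_levelOne (k := 4) (by norm_num)
    (f := fun t => deriv dlogEtaSq t - π * I * (dlogEtaSq t ^ 2 -
      (theta2Sq t ^ 4 + theta3Sq t ^ 4 + theta4Sq t ^ 4) / 72)) ?_ ?_ ?_ ?_ ht
  · linear_combination h
  · have hd : DifferentiableOn ℂ dlogEtaSq {t : ℂ | 0 < t.im} := fun s hs =>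
      (differentiableAt_dlogEtaSq hs).differentiableWithinAt
    intro s hs
    have h1 := (hd.deriv isOpen_upper).differentiableAt (isOpen_upper.mem_nhds hs)
    have h2 := differentiableAt_theta2Sq hs
    have h3 := differentiableAt_theta3Sq hs
    have h4 := differentiableAt_theta4Sq hs
    have h5 := differentiableAt_dlogEtaSq hs
    exact DifferentiableAt.differentiableWithinAt (by fun_prop)
  · intro s _
    have h1 : deriv dlogEtaSq (s + 1) = deriv dlogEtaSq s := by
      rw [← deriv_comp_add_const, funext dlogEtaSq_add_one]
    rw [h1, dlogEtaSq_add_one, theta2Sq_add_one, theta3Sq_add_one, theta4Sq_add_one, mul_pow,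
      I_pow_four]
    ring
  · intro s hs
    have hs0 := ne_zero_of_im_pos hs
    have hinv : HasDerivAt (fun s : ℂ => -1 / s) (1 / s ^ 2) s := by
      have := (hasDerivAt_inv hs0).const_mul (-1)
      refine (this.congr_deriv ?_).congr_of_eventuallyEq (.of_forall fun s => ?_)
      · ring
      · simp [div_eq_mul_inv]
    have h1 : HasDerivAt (fun s => dlogEtaSq (-1 / s)) (deriv dlogEtaSq (-1 / s) * (1 / s ^ 2)) s :=
      HasDerivAt.comp s (differentiableAt_dlogEtaSq (neg_one_div_im_pos hs)).hasDerivAt hinv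
    have h2 : HasDerivAt (fun s => s ^ 2 * dlogEtaSq s + s / (π * I))
        (2 * s * dlogEtaSq s + s ^ 2 * deriv dlogEtaSq s + 1 / (π * I)) s := by
      simpa using ((hasDerivAt_pow 2 s).fun_mul (differentiableAt_dlogEtaSq hs).hasDerivAt).fun_add
        ((hasDerivAt_id s).div_const (π * I))
    have h3 := h1.unique <| h2.congr_of_eventuallyEq <| by
      filter_upwards [isOpen_upper.mem_nhds hs] with s hs using dlogEtaSq_neg_one_div hs
    have h4 : deriv dlogEtaSq (-1 / s) =
        s ^ 2 * (2 * s * dlogEtaSq s + s ^ 2 * deriv dlogEtaSq s + 1 / (π * I)) := by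
      rw [← h3]
      field_simp
    rw [h4, dlogEtaSq_neg_one_div hs, theta2Sq_neg_one_div hs, theta3Sq_neg_one_div hs,
      theta4Sq_neg_one_div hs]
    have hc : (π * I : ℂ) * (1 / (π * I)) = 1 := mul_one_div_cancel hpi
    simp only [mul_pow, (by decide : Even 4).neg_pow, I_pow_four]
    rw [div_eq_mul_one_div s (π * I : ℂ)]
    linear_combination (-2 * s ^ 3 * dlogEtaSq s - s ^ 2 * (1 / (π * I))) * hc
  · have h1 := tendsto_deriv_cuspInfty (fun _ h => differentiableAt_dlogEtaSq h) tendsto_dlogEtaSq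
    have h2 := h1.sub (((tendsto_dlogEtaSq.pow 2).sub
      ((((tendsto_theta2Sq.pow 4).add (tendsto_theta3Sq.pow 4)).add
      (tendsto_theta4Sq.pow 4)).div_const 72)).const_mul (π * I : ℂ))
    convert! h2 using 2
    norm_num

/-! ### The modular equation of degree five -/

/-- The quotient `(θ₃²θ₃²(5·) - θ₂²θ₂²(5·) - θ₄²θ₄²(5·)) / (8 η² η²(5·))`, a modular function
for `Γ₀(5)`. -/
def quotFive (t : ℂ) : ℂ :=
  (theta3Sq t * theta3Sq (5 * t) - theta2Sq t * theta2Sq (5 * t) - theta4Sq t * theta4Sq (5 * t)) /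
    (8 * (etaSq t * etaSq (5 * t)))

theorem five_mul_im_pos {t : ℂ} (ht : 0 < t.im) : 0 < (5 * t).im := by
  simpa using ht

theorem differentiableAt_comp_five {f : ℂ → ℂ}
    (hf : ∀ t : ℂ, 0 < t.im → DifferentiableAt ℂ f t) {t : ℂ} (ht : 0 < t.im) :
    DifferentiableAt ℂ (fun s => f (5 * s)) t :=
  DifferentiableAt.comp t (hf _ (five_mul_im_pos ht)) (by fun_prop)

theorem differentiableAt_quotFive {t : ℂ} (ht : 0 < t.im) : DifferentiableAt ℂ quotFive t := by
  have h2 := differentiableAt_theta2Sq ht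
  have h3 := differentiableAt_theta3Sq ht
  have h4 := differentiableAt_theta4Sq ht
  have h1 := differentiableAt_etaSq ht
  have h2' := differentiableAt_comp_five (fun _ h => differentiableAt_theta2Sq h) ht
  have h3' := differentiableAt_comp_five (fun _ h => differentiableAt_theta3Sq h) ht
  have h4' := differentiableAt_comp_five (fun _ h => differentiableAt_theta4Sq h) ht
  have h1' := differentiableAt_comp_five (fun _ h => differentiableAt_etaSq h) ht
  exact (((h3.mul h3').sub (h2.mul h2')).sub (h4.mul h4')).div ((h1.mul h1').const_mul 8)
    (mul_ne_zero (by norm_num) (mul_ne_zero (etaSq_ne_zero ht) (etaSq_ne_zero (five_mul_im_pos ht))))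

theorem theta3Sq_add_two (t : ℂ) : theta3Sq (t + 2) = theta3Sq t := by
  rw [show t + 2 = t + 1 + 1 by ring, theta3Sq_add_one, theta4Sq_add_one]

theorem theta4Sq_add_two (t : ℂ) : theta4Sq (t + 2) = theta4Sq t := by
  rw [show t + 2 = t + 1 + 1 by ring, theta4Sq_add_one, theta3Sq_add_one]

theorem theta2Sq_add_two (t : ℂ) : theta2Sq (t + 2) = -theta2Sq t := by
  rw [show t + 2 = t + 1 + 1 by ring, theta2Sq_add_one, theta2Sq_add_one]
  linear_combination theta2Sq t * I_sq

theorem etaSq_add_two (t : ℂ) : etaSq (t + 2) = exp (π * I / 6) ^ 2 * etaSq t := by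
  rw [show t + 2 = t + 1 + 1 by ring, etaSq_add_one, etaSq_add_one]
  ring

theorem theta3Sq_sub_two (t : ℂ) : theta3Sq (t - 2) = theta3Sq t := by
  rw [← theta3Sq_add_two (t - 2), sub_add_cancel]

theorem theta4Sq_sub_two (t : ℂ) : theta4Sq (t - 2) = theta4Sq t := by
  rw [← theta4Sq_add_two (t - 2), sub_add_cancel]

theorem theta2Sq_sub_two (t : ℂ) : theta2Sq (t - 2) = -theta2Sq t := by
  rw [← sub_add_cancel t 2, theta2Sq_add_two, sub_add_cancel, neg_neg]

theorem etaSq_sub_two (t : ℂ) : etaSq (t - 2) = (exp (π * I / 6) ^ 2)⁻¹ * etaSq t := by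
  have h := etaSq_add_two (t - 2)
  rw [sub_add_cancel] at h
  rw [h, inv_mul_cancel_left₀ (pow_ne_zero 2 (Complex.exp_ne_zero _))]

theorem exp_pi_div_six_pow_six : exp (π * I / 6) ^ 6 = -1 := by
  rw [← Complex.exp_nat_mul, show ((6 : ℕ) : ℂ) * (π * I / 6) = π * I by push_cast; ring,
    Complex.exp_pi_mul_I]

theorem quotFive_add_one (t : ℂ) : quotFive (t + 1) = quotFive t := by
  have h5 : 5 * (t + 1) = 5 * t + 1 + 2 + 2 := by ring
  have hη : etaSq (t + 1) * etaSq (5 * (t + 1)) = -(etaSq t * etaSq (5 * t)) := by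
    rw [h5, etaSq_add_two, etaSq_add_two, etaSq_add_one, etaSq_add_one]
    linear_combination etaSq t * etaSq (5 * t) * exp_pi_div_six_pow_six
  have h2 : theta2Sq (t + 1) * theta2Sq (5 * (t + 1)) = -(theta2Sq t * theta2Sq (5 * t)) := by
    rw [h5, theta2Sq_add_two, theta2Sq_add_two, theta2Sq_add_one, theta2Sq_add_one]
    linear_combination theta2Sq t * theta2Sq (5 * t) * I_sq
  rw [quotFive, quotFive, hη, h2, h5, theta3Sq_add_two, theta3Sq_add_two, theta3Sq_add_one,
    theta3Sq_add_one, theta4Sq_add_two, theta4Sq_add_two, theta4Sq_add_one, theta4Sq_add_one,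
    mul_neg, div_neg, ← neg_div]
  ring_nf

theorem quotFive_sub_one (t : ℂ) : quotFive (t - 1) = quotFive t := by
  rw [← quotFive_add_one (t - 1), sub_add_cancel]

/-- Invariance under the Fricke involution. -/
theorem quotFive_fricke {t : ℂ} (ht : 0 < t.im) : quotFive (-1 / (5 * t)) = quotFive t := by
  have ht0 := ne_zero_of_im_pos ht
  have ht5 := five_mul_im_pos ht
  have h5 : 5 * (-1 / (5 * t)) = -1 / t := by field_simp
  rw [quotFive, quotFive, h5, theta2Sq_neg_one_div ht, theta3Sq_neg_one_div ht,
    theta4Sq_neg_one_div ht, etaSq_neg_one_div ht, theta2Sq_neg_one_div ht5,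
    theta3Sq_neg_one_div ht5, theta4Sq_neg_one_div ht5, etaSq_neg_one_div ht5]
  have h1 := etaSq_ne_zero ht
  have h2 := etaSq_ne_zero ht5
  have hI := I_ne_zero
  generalize theta2Sq (5 * t) = a, theta3Sq (5 * t) = b, theta4Sq (5 * t) = c at *
  generalize etaSq (5 * t) = d at *
  field_simp
  ring

/-- Invariance under an elliptic element of order four of `Γ₀(5)`, written as a word in the
generators of `SL₂(ℤ)` both for `t` and for `5t`. -/
theorem quotFive_elliptic {t : ℂ} (ht : 0 < t.im) :
    quotFive ((2 * t - 1) / (5 * t - 2)) = quotFive t := by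
  have ht0 := ne_zero_of_im_pos ht
  have ht5 := five_mul_im_pos ht
  have hω := Complex.exp_ne_zero (π * I / 6)
  -- `(2t - 1)/(5t - 2) = -1/v` with `v = -1/u - 2` and `u = -1/t + 2`, while five times it is
  -- `-1/(5t - 2) + 2`.
  obtain ⟨u, hu⟩ : ∃ u, u = -1 / t + 2 := ⟨_, rfl⟩
  have hu_im : 0 < u.im := by
    have := neg_one_div_im_pos ht
    rw [hu]; simpa using this
  obtain ⟨v, hv⟩ : ∃ v, v = -1 / u - 2 := ⟨_, rfl⟩
  have hv_im : 0 < v.im := by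
    have := neg_one_div_im_pos hu_im
    rw [hv]; simpa using this
  have hu0 := ne_zero_of_im_pos hu_im
  have hv0 := ne_zero_of_im_pos hv_im
  have hut : u * t = 2 * t - 1 := by rw [hu]; field_simp; ring
  have huv : v * u * t = -(5 * t - 2) := by
    have : v * u = -1 - 2 * u := by rw [hv]; field_simp
    rw [this]; linear_combination -2 * hut
  have h52 : 5 * t - 2 ≠ 0 := by
    intro h
    rw [h, neg_zero] at huv
    exact mul_ne_zero (mul_ne_zero hv0 hu0) ht0 huv
  have hγ : (2 * t - 1) / (5 * t - 2) = -1 / v := by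
    rw [div_eq_div_iff h52 hv0, ← hut]
    linear_combination huv
  have hw_im : 0 < (5 * t - 2).im := by simpa using ht
  have hγ5 : 5 * ((2 * t - 1) / (5 * t - 2)) = -1 / (5 * t - 2) + 2 := by
    field_simp
    ring
  have e3 : theta3Sq (-1 / v) = -I * (5 * t - 2) * theta3Sq t := by
    rw [theta3Sq_neg_one_div hv_im, hv, theta3Sq_sub_two, theta3Sq_neg_one_div hu_im, ← hv]
    rw [hu, theta3Sq_add_two, theta3Sq_neg_one_div ht, ← hu]
    linear_combination (-I ^ 3 * theta3Sq t) * huv + I * (5 * t - 2) * theta3Sq t * I_sq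
  have e2 : theta2Sq (-1 / v) = I * (5 * t - 2) * theta4Sq t := by
    rw [theta2Sq_neg_one_div hv_im, hv, theta4Sq_sub_two, theta4Sq_neg_one_div hu_im, ← hv]
    rw [hu, theta2Sq_add_two, theta2Sq_neg_one_div ht, ← hu]
    linear_combination (I ^ 3 * theta4Sq t) * huv - I * (5 * t - 2) * theta4Sq t * I_sq
  have e4 : theta4Sq (-1 / v) = I * (5 * t - 2) * theta2Sq t := by
    rw [theta4Sq_neg_one_div hv_im, hv, theta2Sq_sub_two, theta2Sq_neg_one_div hu_im, ← hv]
    rw [hu, theta4Sq_add_two, theta4Sq_neg_one_div ht, ← hu]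
    linear_combination (I ^ 3 * theta2Sq t) * huv - I * (5 * t - 2) * theta2Sq t * I_sq
  have e1 : etaSq (-1 / v) = -I * (5 * t - 2) * etaSq t := by
    rw [etaSq_neg_one_div hv_im, hv, etaSq_sub_two, etaSq_neg_one_div hu_im, ← hv]
    rw [hu, etaSq_add_two, etaSq_neg_one_div ht, ← hu]
    field_simp
    linear_combination (-I ^ 2 * etaSq t) * huv + (5 * t - 2) * etaSq t * I_sq
  have f3 : theta3Sq (-1 / (5 * t - 2) + 2) = -I * (5 * t - 2) * theta3Sq (5 * t) := by
    rw [theta3Sq_add_two, theta3Sq_neg_one_div hw_im, theta3Sq_sub_two]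
  have f2 : theta2Sq (-1 / (5 * t - 2) + 2) = I * (5 * t - 2) * theta4Sq (5 * t) := by
    rw [theta2Sq_add_two, theta2Sq_neg_one_div hw_im, theta4Sq_sub_two]
    ring
  have f4 : theta4Sq (-1 / (5 * t - 2) + 2) = I * (5 * t - 2) * theta2Sq (5 * t) := by
    rw [theta4Sq_add_two, theta4Sq_neg_one_div hw_im, theta2Sq_sub_two]
    ring
  have f1 : etaSq (-1 / (5 * t - 2) + 2) = -I * (5 * t - 2) * etaSq (5 * t) := by
    rw [etaSq_add_two, etaSq_neg_one_div hw_im, etaSq_sub_two]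
    field_simp
  rw [quotFive, hγ5, hγ, e1, e2, e3, e4, f1, f2, f3, f4, quotFive]
  have h1 := etaSq_ne_zero ht
  have h2 := etaSq_ne_zero ht5
  have hI := I_ne_zero
  generalize theta2Sq (5 * t) = a, theta3Sq (5 * t) = b, theta4Sq (5 * t) = c at *
  generalize etaSq (5 * t) = d at *
  generalize 5 * t - 2 = w at *
  field_simp
  ring

theorem tendsto_quotFive : Tendsto quotFive cuspInfty (𝓝 1) := by
  -- `Z - r` is the odd part `K(q) - K(-q)`, where `K(q) = 1 + 4q + ⋯`, and `p = O(q³)`, `z ∼ q`.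
  set K : ℂ → ℂ := fun q => theta3SqSeries q * theta3SqSeries (q ^ 5) with hK
  have hK' : HasDerivAt K 4 0 := by
    have h5 : HasDerivAt (fun q : ℂ => theta3SqSeries (q ^ 5)) (4 * (5 * 0 ^ 4)) 0 := by
      have hp : HasDerivAt (fun q : ℂ => q ^ 5) (5 * 0 ^ 4) 0 := by
        simpa using hasDerivAt_pow 5 (0 : ℂ)
      refine HasDerivAt.comp (0 : ℂ) (h₂ := theta3SqSeries) ?_ hp
      simpa using hasDerivAt_theta3SqSeries
    exact (hasDerivAt_theta3SqSeries.fun_mul h5).congr_deriv (by simp)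
  have hodd : HasDerivAt (fun q => K q - K (-q)) 8 0 := by
    have hneg : HasDerivAt (fun q => K (-q)) (4 * -1) 0 :=
      HasDerivAt.comp (0 : ℂ) (h₂ := K) (by simpa using hK') (hasDerivAt_neg 0)
    exact (hK'.fun_sub hneg).congr_deriv (by norm_num)
  have hslope := hodd.tendsto_slope.comp tendsto_exp_cuspInfty
  have hq := (tendsto_nhdsWithin_iff.mp tendsto_exp_cuspInfty).1
  have hq5 : Tendsto (fun t : ℂ => exp (π * I * t) ^ 5) cuspInfty (𝓝 0) := by
    simpa using hq.pow 5
  have comp5 : ∀ {F : ℂ → ℂ}, DifferentiableOn ℂ F (Metric.ball 0 (1 / 2)) →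
      Tendsto (fun t : ℂ => F (exp (π * I * t) ^ 5)) cuspInfty (𝓝 (F 0)) := fun hF =>
    (hF.differentiableAt ball_half_mem_nhds).continuousAt.tendsto.comp hq5
  have hfin := (hslope.sub ((hq.pow 2).mul ((tendsto_series differentiableOn_theta2SqSeries).mul
    (comp5 differentiableOn_theta2SqSeries)))).div
    (((tendsto_series differentiableOn_etaSqSeries).mul
      (comp5 differentiableOn_etaSqSeries)).const_mul 8) (by simp)
  have hval : (8 - 0 ^ 2 * (theta2SqSeries 0 * theta2SqSeries 0)) /
      (8 * (etaSqSeries 0 * etaSqSeries 0)) = 1 := by simp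
  rw [hval] at hfin
  refine hfin.congr' ?_
  filter_upwards [eventually_im_pos] with t ht
  have ht5 := five_mul_im_pos ht
  have e5 : exp (π * I * (5 * t)) = exp (π * I * t) ^ 5 := by
    rw [← Complex.exp_nat_mul]; congr 1; push_cast; ring
  have ehalf : exp (π * I * (1 / 2) * t) * exp (π * I * (1 / 2) * (5 * t)) = exp (π * I * t) ^ 3 := by
    rw [← Complex.exp_nat_mul, ← Complex.exp_add]; congr 1; push_cast; ring
  have esix : exp (π * I * (1 / 6) * t) * exp (π * I * (1 / 6) * (5 * t)) = exp (π * I * t) := by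
    rw [← Complex.exp_add]; congr 1; ring
  have h2 : theta2Sq t * theta2Sq (5 * t) = exp (π * I * t) ^ 3 *
      (theta2SqSeries (exp (π * I * t)) * theta2SqSeries (exp (π * I * t) ^ 5)) := by
    rw [theta2Sq_eq_series ht, theta2Sq_eq_series ht5, e5, ← ehalf]; ring
  have h1 : etaSq t * etaSq (5 * t) = exp (π * I * t) *
      (etaSqSeries (exp (π * I * t)) * etaSqSeries (exp (π * I * t) ^ 5)) := by
    rw [etaSq_eq_series t, etaSq_eq_series (5 * t), e5]
    linear_combination (etaSqSeries (exp (π * I * t)) * etaSqSeries (exp (π * I * t) ^ 5)) * esix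
  have h3 : theta3Sq t * theta3Sq (5 * t) = K (exp (π * I * t)) := by
    rw [theta3Sq_eq_series ht, theta3Sq_eq_series ht5, e5]
  have h4 : theta4Sq t * theta4Sq (5 * t) = K (-exp (π * I * t)) := by
    rw [theta4Sq_eq_series ht, theta4Sq_eq_series ht5, e5, hK]
    simp only [(by decide : Odd 5).neg_pow]
  have hE := Complex.exp_ne_zero (π * I * t)
  rw [quotFive, h1, h2, h3, h4]
  simp only [Pi.div_apply, Function.comp, slope_def_field, neg_zero, sub_self, sub_zero]
  generalize exp (π * I * t) = q at *
  rw [show 8 * (q * (etaSqSeries q * etaSqSeries (q ^ 5))) =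
    q * (8 * (etaSqSeries q * etaSqSeries (q ^ 5))) by ring,
    ← div_div (K q - _ - _) q]
  congr 1
  field_simp
  ring

theorem add_div_five_im_pos (k : ℝ) {s : ℂ} (hs : 0 < s.im) : 0 < ((s + k) / 5).im := by
  rw [show (s + k) / 5 = ((1 / 5 : ℝ) : ℂ) * (s + k) by push_cast; ring, Complex.im_ofReal_mul]
  simpa using hs

theorem quotFive_neg_one_div {s : ℂ} (hs : 0 < s.im) : quotFive (-1 / s) = quotFive (s / 5) := by
  have h := quotFive_fricke (add_div_five_im_pos 0 hs)
  simp only [ofReal_zero, add_zero] at h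
  rwa [show 5 * (s / 5) = s by ring] at h

theorem quotFive_neg_one_div_div {s : ℂ} (hs : 0 < s.im) :
    quotFive (-1 / s / 5) = quotFive s := by
  rw [← quotFive_fricke hs]
  congr 1
  field_simp

theorem quotFive_shift_one {s : ℂ} (hs : 0 < s.im) :
    quotFive ((-1 / s + 1) / 5) = quotFive ((s + -1) / 5) := by
  have hs0 := ne_zero_of_im_pos hs
  have hs1 : 0 < (s - 1).im := by simpa using hs
  have hs10 := ne_zero_of_im_pos hs1
  have h1 := add_div_five_im_pos 1 (neg_one_div_im_pos hs)
  rw [ofReal_one] at h1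
  rw [← quotFive_fricke h1, ← sub_eq_add_neg, ← quotFive_neg_one_div hs1,
    ← quotFive_sub_one (-1 / (s - 1))]
  congr 1
  have : -1 / s + 1 ≠ 0 := by
    rw [show -1 / s + 1 = (s - 1) / s by field_simp; ring]
    exact div_ne_zero hs10 hs0
  have h3 : -1 + s ≠ 0 := by rwa [neg_add_eq_sub]
  field_simp
  ring

theorem quotFive_shift_neg_one {s : ℂ} (hs : 0 < s.im) :
    quotFive ((-1 / s + -1) / 5) = quotFive ((s + 1) / 5) := by
  have h := quotFive_shift_one (neg_one_div_im_pos hs)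
  have hs0 := ne_zero_of_im_pos hs
  rw [show -1 / (-1 / s) = s by field_simp] at h
  exact h.symm

theorem quotFive_shift_two {s : ℂ} (hs : 0 < s.im) :
    quotFive ((-1 / s + 2) / 5) = quotFive ((s + 2) / 5) := by
  have hs0 := ne_zero_of_im_pos hs
  have h := quotFive_elliptic (t := (s + 2) / 5) (by simpa using add_div_five_im_pos 2 hs)
  rw [← h]
  congr 1
  rw [show 5 * ((s + 2) / 5) - 2 = s by ring]
  field_simp
  ring

theorem quotFive_shift_neg_two {s : ℂ} (hs : 0 < s.im) :
    quotFive ((-1 / s + -2) / 5) = quotFive ((s + -2) / 5) := by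
  have hs0 := ne_zero_of_im_pos hs
  have hx : 0 < ((s + -2) / 5).im := by simpa using add_div_five_im_pos (-2) hs
  have hx' : 0 < (5 * ((s + -2) / 5)).im := five_mul_im_pos hx
  have hy := neg_one_div_im_pos hx'
  have hz : 0 < ((-1 / s + -2) / 5).im := by
    simpa using add_div_five_im_pos (-2) (neg_one_div_im_pos hs)
  have hs2 : s + -2 ≠ 0 := by
    have : 0 < (s + -2).im := by simpa using hs
    exact ne_zero_of_im_pos this
  rw [← quotFive_fricke hx, ← quotFive_elliptic hy, ← quotFive_fricke hz]
  congr 1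
  have h1 : -1 / s + -2 ≠ 0 := by
    have : 0 < (-1 / s + -2).im := by simpa using neg_one_div_im_pos hs
    exact ne_zero_of_im_pos this
  have h2 : -1 / s + -2 = -(1 + 2 * s) / s := by field_simp; ring
  have h3 : 1 + 2 * s ≠ 0 := by
    intro h
    rw [h2, h] at h1
    simp at h1
  have h4 : 5 * (-1 / (5 * ((s + -2) / 5))) - 2 = -(1 + 2 * s) / (s + -2) := by
    field_simp
    ring
  rw [h4, h2]
  field_simp
  ring

theorem differentiableAt_quotFive_shift (k : ℝ) {s : ℂ} (hs : 0 < s.im) :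
    DifferentiableAt ℂ (fun t => quotFive ((t + k) / 5)) s :=
  DifferentiableAt.comp s (g := quotFive) (differentiableAt_quotFive (add_div_five_im_pos k hs))
    (by fun_prop)

theorem tendsto_quotFive_shift (k : ℝ) :
    Tendsto (fun t => quotFive ((t + k) / 5)) cuspInfty (𝓝 1) := by
  have h := tendsto_quotFive.comp ((tendsto_mul_cuspInfty (c := 1 / 5) (by norm_num)).comp
    (tendsto_add_cuspInfty k))
  refine h.congr fun s => ?_
  simp only [Function.comp]
  congr 1
  push_cast
  ring

/-- The quotient `quotFive` is identically `1`. The six functions `quotFive t` and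
`quotFive ((t + k)/5)` are permuted by `SL₂(ℤ)` and tend to `1` at the cusp, so that for each `c`
the product of the `c - quotFive` over the six of them is the constant `(c - 1) ^ 6`. -/
theorem quotFive_eq_one {t : ℂ} (ht : 0 < t.im) : quotFive t = 1 := by
  have key : ∀ c : ℂ, (c - quotFive t) * ((c - quotFive ((t + (0 : ℝ)) / 5)) *
      ((c - quotFive ((t + (1 : ℝ)) / 5)) * ((c - quotFive ((t + (-1 : ℝ)) / 5)) *
      ((c - quotFive ((t + (2 : ℝ)) / 5)) * (c - quotFive ((t + (-2 : ℝ)) / 5)))))) -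
      (c - 1) ^ 6 = 0 := by
    intro c
    refine eq_zero_of_levelOne (k := 0) (by norm_num)
      (f := fun t => (c - quotFive t) * ((c - quotFive ((t + (0 : ℝ)) / 5)) *
      ((c - quotFive ((t + (1 : ℝ)) / 5)) * ((c - quotFive ((t + (-1 : ℝ)) / 5)) *
      ((c - quotFive ((t + (2 : ℝ)) / 5)) * (c - quotFive ((t + (-2 : ℝ)) / 5)))))) -
      (c - 1) ^ 6) ?_ ?_ ?_ ?_ ht
    · intro s hs
      have d := fun k : ℝ => (differentiableAt_quotFive_shift k hs).const_sub c
      exact ((((differentiableAt_quotFive hs).const_sub c).mul ((d 0).mul ((d 1).mul ((d (-1)).mul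
        ((d 2).mul (d (-2))))))).sub_const ((c - 1) ^ 6)).differentiableWithinAt
    · intro s _
      push_cast
      rw [quotFive_add_one, show (s + 1 + 0) / 5 = (s + 1) / 5 by ring,
        show (s + 1 + 1) / 5 = (s + 2) / 5 by ring,
        show (s + 1 + -1) / 5 = (s + 0) / 5 by ring,
        show (s + 1 + 2) / 5 = (s + -2) / 5 + 1 by ring, quotFive_add_one,
        show (s + 1 + -2) / 5 = (s + -1) / 5 by ring]
      ring
    · intro s hs
      push_cast
      rw [quotFive_neg_one_div hs, add_zero, add_zero, quotFive_neg_one_div_div hs,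
        quotFive_shift_one hs, quotFive_shift_neg_one hs, quotFive_shift_two hs,
        quotFive_shift_neg_two hs]
      ring
    · have l := fun k : ℝ => (tendsto_quotFive_shift k).const_sub c
      have := ((tendsto_quotFive.const_sub c).mul ((l 0).mul ((l 1).mul ((l (-1)).mul
        ((l 2).mul (l (-2))))))).sub_const ((c - 1) ^ 6)
      rwa [show (c - 1) * ((c - 1) * ((c - 1) * ((c - 1) * ((c - 1) * (c - 1))))) - (c - 1) ^ 6 = 0
        by ring] at this
  -- Taking `c` to be one of the six values makes the product vanish.
  have h := key (quotFive t)
  rwa [sub_self, zero_mul, zero_sub, neg_eq_zero, pow_eq_zero_iff (by norm_num), sub_eq_zero] at h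

/-! ### The differential ring at level twenty -/

/-- `θ₂(t)² θ₂(5t)²`. -/
def theta2Prod (t : ℂ) : ℂ := theta2Sq t * theta2Sq (5 * t)

/-- `θ₃(t)² θ₃(5t)²`. -/
def theta3Prod (t : ℂ) : ℂ := theta3Sq t * theta3Sq (5 * t)

/-- `θ₄(t)² θ₄(5t)²`. -/
def theta4Prod (t : ℂ) : ℂ := theta4Sq t * theta4Sq (5 * t)

/-- `η(t)² η(5t)²`. -/
def etaProd (t : ℂ) : ℂ := etaSq t * etaSq (5 * t)

theorem theta4Prod_ne_zero {t : ℂ} (ht : 0 < t.im) : theta4Prod t ≠ 0 :=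
  mul_ne_zero (theta4Sq_ne_zero ht) (theta4Sq_ne_zero (five_mul_im_pos ht))

theorem theta3Prod_ne_zero {t : ℂ} (ht : 0 < t.im) : theta3Prod t ≠ 0 :=
  mul_ne_zero (theta3Sq_ne_zero ht) (theta3Sq_ne_zero (five_mul_im_pos ht))

theorem etaProd_ne_zero {t : ℂ} (ht : 0 < t.im) : etaProd t ≠ 0 :=
  mul_ne_zero (etaSq_ne_zero ht) (etaSq_ne_zero (five_mul_im_pos ht))

/-- The modular equation of degree five. -/
theorem modular_equation {t : ℂ} (ht : 0 < t.im) :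
    theta3Prod t = theta2Prod t + theta4Prod t + 8 * etaProd t := by
  have h := quotFive_eq_one ht
  have h0 := etaProd_ne_zero ht
  rw [etaProd] at h0
  rw [quotFive, div_eq_one_iff_eq (mul_ne_zero (by norm_num) h0)] at h
  rw [theta3Prod, theta2Prod, theta4Prod, etaProd]
  linear_combination h

/-- `prZ = 16z³`. -/
theorem theta_prod_mul {t : ℂ} (ht : 0 < t.im) :
    theta2Prod t * theta4Prod t * theta3Prod t = 16 * etaProd t ^ 3 := by
  have h1 := theta_mul_theta_mul_theta ht
  have h2 := theta_mul_theta_mul_theta (five_mul_im_pos ht)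
  rw [theta3Prod, theta2Prod, theta4Prod, etaProd]
  linear_combination theta2Sq (5 * t) * theta3Sq (5 * t) * theta4Sq (5 * t) * h1 +
    4 * etaSq t ^ 3 * h2

/-- A holomorphic function vanishing near the cusp vanishes on the whole upper half-plane. -/
theorem eq_zero_of_eventually_cuspInfty {f : ℂ → ℂ}
    (hf : ∀ t : ℂ, 0 < t.im → DifferentiableAt ℂ f t) (h : ∀ᶠ t in cuspInfty, f t = 0)
    {t : ℂ} (ht : 0 < t.im) : f t = 0 := by
  rw [eventually_comap, eventually_atTop] at h
  obtain ⟨M, hM⟩ := h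
  have hd : DifferentiableOn ℂ f {t : ℂ | 0 < t.im} := fun s hs => (hf s hs).differentiableWithinAt
  have hz : ((max M 0 + 1 : ℝ) * I : ℂ).im = max M 0 + 1 := by simp
  have hz0 : 0 < ((max M 0 + 1 : ℝ) * I : ℂ).im := by
    rw [hz]; linarith [le_max_right M 0]
  refine (hd.analyticOnNhd isOpen_upper).eqOn_zero_of_preconnected_of_eventuallyEq_zero
    (convex_halfSpace_im_gt 0).isPreconnected hz0 ?_ ht
  have : {s : ℂ | M < s.im} ∈ 𝓝 ((max M 0 + 1 : ℝ) * I : ℂ) := by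
    refine (isOpen_lt continuous_const Complex.continuous_im).mem_nhds ?_
    simp only [Set.mem_ofPred_eq, hz]
    linarith [le_max_left M 0]
  filter_upwards [this] with s hs using hM s.im (le_of_lt hs) s rfl

theorem tendsto_five_mul : Tendsto (fun t : ℂ => 5 * t) cuspInfty cuspInfty := by
  simpa using tendsto_mul_cuspInfty (c := 5) (by norm_num)

theorem tendsto_theta2Prod : Tendsto theta2Prod cuspInfty (𝓝 0) := by
  simpa using! tendsto_theta2Sq.mul (tendsto_theta2Sq.comp tendsto_five_mul)

theorem tendsto_theta4Prod : Tendsto theta4Prod cuspInfty (𝓝 1) := by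
  simpa using! tendsto_theta4Sq.mul (tendsto_theta4Sq.comp tendsto_five_mul)

theorem tendsto_etaProd : Tendsto etaProd cuspInfty (𝓝 0) := by
  simpa using! tendsto_etaSq.mul (tendsto_etaSq.comp tendsto_five_mul)

/-- `D log (η(5t)²)`. -/
def dlogEtaSqFive (t : ℂ) : ℂ := 5 * dlogEtaSq (5 * t)

theorem hasDerivAt_comp_five {f : ℂ → ℂ} {f' t : ℂ} (hf : HasDerivAt f f' (5 * t)) :
    HasDerivAt (fun s => f (5 * s)) (f' * 5) t := by
  have : HasDerivAt (fun s : ℂ => 5 * s) 5 t := by simpa using (hasDerivAt_id t).const_mul 5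
  exact HasDerivAt.comp t hf this

/-- The product rule in the form `D(fg) = fg (D log f + D log g)`. -/
theorem hasDerivAt_mul_five {f : ℂ → ℂ} {t a b : ℂ}
    (h1 : HasDerivAt f (π * I * (f t * (dlogEtaSq t + a))) t)
    (h2 : HasDerivAt f (π * I * (f (5 * t) * (dlogEtaSq (5 * t) + b))) (5 * t)) :
    HasDerivAt (fun s => f s * f (5 * s))
      (π * I * (f t * f (5 * t) * (dlogEtaSq t + dlogEtaSqFive t + (a + 5 * b)))) t := by
  refine (h1.fun_mul (hasDerivAt_comp_five h2)).congr_deriv ?_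
  rw [dlogEtaSqFive]
  ring

theorem hasDerivAt_etaProd {t : ℂ} (ht : 0 < t.im) :
    HasDerivAt etaProd (π * I * (etaProd t * (dlogEtaSq t + dlogEtaSqFive t))) t := by
  refine (hasDerivAt_mul_five (a := 0) (b := 0) ?_ ?_).congr_deriv (by rw [etaProd]; ring)
  · simpa using hasDerivAt_etaSq ht
  · simpa using hasDerivAt_etaSq (five_mul_im_pos ht)

/-- `θ₂(t)⁴ + 5 θ₂(5t)⁴`. -/
def theta2Sum (t : ℂ) : ℂ := theta2Sq t ^ 2 + 5 * theta2Sq (5 * t) ^ 2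

/-- `θ₄(t)⁴ + 5 θ₄(5t)⁴`. -/
def theta4Sum (t : ℂ) : ℂ := theta4Sq t ^ 2 + 5 * theta4Sq (5 * t) ^ 2

theorem hasDerivAt_theta2Prod {t : ℂ} (ht : 0 < t.im) :
    HasDerivAt theta2Prod (π * I * (theta2Prod t * (dlogEtaSq t + dlogEtaSqFive t +
      (2 * theta4Sum t + theta2Sum t) / 6))) t := by
  refine (hasDerivAt_mul_five (hasDerivAt_theta2Sq ht)
    (hasDerivAt_theta2Sq (five_mul_im_pos ht))).congr_deriv ?_
  rw [jacobi_identity ht, jacobi_identity (five_mul_im_pos ht), theta2Prod, theta2Sum, theta4Sum]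
  ring

theorem hasDerivAt_theta3Prod {t : ℂ} (ht : 0 < t.im) :
    HasDerivAt theta3Prod (π * I * (theta3Prod t * (dlogEtaSq t + dlogEtaSqFive t +
      (theta2Sum t - theta4Sum t) / 6))) t := by
  refine (hasDerivAt_mul_five (hasDerivAt_theta3Sq ht)
    (hasDerivAt_theta3Sq (five_mul_im_pos ht))).congr_deriv ?_
  rw [theta3Prod, theta2Sum, theta4Sum]
  ring

theorem hasDerivAt_theta4Prod {t : ℂ} (ht : 0 < t.im) :
    HasDerivAt theta4Prod (π * I * (theta4Prod t * (dlogEtaSq t + dlogEtaSqFive t -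
      (2 * theta2Sum t + theta4Sum t) / 6))) t := by
  refine (hasDerivAt_mul_five (hasDerivAt_theta4Sq ht)
    (hasDerivAt_theta4Sq (five_mul_im_pos ht))).congr_deriv ?_
  rw [jacobi_identity ht, jacobi_identity (five_mul_im_pos ht), theta4Prod, theta2Sum, theta4Sum]
  ring

/-- The derivative of the modular equation: a linear relation between the two sums. -/
theorem theta_sum_relation {t : ℂ} (ht : 0 < t.im) :
    theta4Sum t * (3 * theta2Prod t + 8 * etaProd t) =
      theta2Sum t * (3 * theta4Prod t + 8 * etaProd t) := by
  have h1 := (((hasDerivAt_theta2Prod ht).fun_add (hasDerivAt_theta4Prod ht)).fun_add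
    ((hasDerivAt_etaProd ht).const_mul 8)).congr_of_eventuallyEq (f₁ := theta3Prod) <| by
      filter_upwards [isOpen_upper.mem_nhds ht] with s hs using modular_equation hs
  have h2 := h1.unique (hasDerivAt_theta3Prod ht)
  have hm := modular_equation ht
  have h3 := mul_left_cancel₀ pi_mul_I_ne_zero (Eq.trans (by ring) h2 :
    (π * I : ℂ) * (theta2Prod t * (dlogEtaSq t + dlogEtaSqFive t +
      (2 * theta4Sum t + theta2Sum t) / 6) + theta4Prod t * (dlogEtaSq t + dlogEtaSqFive t -
      (2 * theta2Sum t + theta4Sum t) / 6) + 8 * (etaProd t * (dlogEtaSq t + dlogEtaSqFive t))) = _)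
  linear_combination 6 * h3 +
    (6 * (dlogEtaSq t + dlogEtaSqFive t) + theta2Sum t - theta4Sum t) * hm

/-- `θ₂(t)⁴ θ₄(5t)⁴ + θ₂(5t)⁴ θ₄(t)⁴` in terms of the products: the product of Jacobi's identities
at `t` and `5t`, combined with the modular equation. -/
theorem theta_mixed {t : ℂ} (ht : 0 < t.im) :
    theta2Sq t ^ 2 * theta4Sq (5 * t) ^ 2 + theta2Sq (5 * t) ^ 2 * theta4Sq t ^ 2 =
      2 * theta2Prod t * theta4Prod t + 16 * etaProd t * (theta2Prod t + theta4Prod t) +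
        64 * etaProd t ^ 2 := by
  have h1 := jacobi_identity ht
  have h2 := jacobi_identity (five_mul_im_pos ht)
  have h3 : theta3Prod t ^ 2 = (theta2Prod t + theta4Prod t + 8 * etaProd t) ^ 2 := by
    rw [modular_equation ht]
  rw [theta3Prod, mul_pow, h1, h2] at h3
  simp only [theta2Prod, theta4Prod] at h3 ⊢
  linear_combination h3

/-- Elimination of `U = θ₂(t)⁴ + 5θ₂(5t)⁴`: up to a factor which is nonzero near the cusp, the
square of `V = θ₄(t)⁴ + 5θ₄(5t)⁴` is that of `6r + 16z`. -/
theorem theta4Sum_sq {t : ℂ} (ht : 0 < t.im) :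
    etaProd t ^ 2 * ((theta2Prod t + theta4Prod t) ^ 2 - theta2Prod t * theta4Prod t +
      8 * etaProd t * (theta2Prod t + theta4Prod t) + 20 * etaProd t ^ 2) *
      (theta4Sum t ^ 2 - (6 * theta4Prod t + 16 * etaProd t) ^ 2) = 0 := by
  have hrel := theta_sum_relation ht
  have hprod := theta_prod_mul ht
  rw [modular_equation ht] at hprod
  have hN := theta_mixed ht
  set p := theta2Prod t with hp
  set r := theta4Prod t with hr
  set z := etaProd t
  set U := theta2Sum t with hU
  set V := theta4Sum t with hV
  obtain ⟨N, hNdef⟩ : ∃ N, N = 2 * p * r + 16 * z * (p + r) + 64 * z ^ 2 := ⟨_, rfl⟩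
  -- With `α = θ₂(t)⁴`, `β = 5θ₂(5t)⁴`, `γ = θ₄(t)⁴`, `δ = 5θ₄(5t)⁴` one has `U = α + β`,
  -- `V = γ + δ`, `5p² = αβ`, `5r² = γδ`, `5N = αδ + βγ`, and these five quantities satisfy one
  -- quadratic relation.
  have hE : 20 * U * V * N - 20 * (p ^ 2 * V ^ 2 + r ^ 2 * U ^ 2) + 400 * p ^ 2 * r ^ 2
      - 100 * N ^ 2 = 0 := by
    rw [hNdef, ← hN, hp, hr, hU, hV, theta2Prod, theta4Prod, theta2Sum, theta4Sum]
    ring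
  have h1 : 20 * V ^ 2 * ((3 * p + 8 * z) * (3 * r + 8 * z) * N - p ^ 2 * (3 * r + 8 * z) ^ 2 -
      r ^ 2 * (3 * p + 8 * z) ^ 2) + (400 * p ^ 2 * r ^ 2 - 100 * N ^ 2) * (3 * r + 8 * z) ^ 2 = 0 := by
    linear_combination (3 * r + 8 * z) ^ 2 * hE + (20 * V * (3 * r + 8 * z) * N -
      20 * r ^ 2 * (U * (3 * r + 8 * z) + V * (3 * p + 8 * z))) * hrel
  have hK : (3 * p + 8 * z) * (3 * r + 8 * z) * N - p ^ 2 * (3 * r + 8 * z) ^ 2 -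
      r ^ 2 * (3 * p + 8 * z) ^ 2 =
      320 * z ^ 2 * ((p + r) ^ 2 - p * r + 8 * z * (p + r) + 20 * z ^ 2) := by
    rw [hNdef]
    linear_combination 144 * z * hprod
  have hD : 100 * N ^ 2 - 400 * p ^ 2 * r ^ 2 =
      25600 * z ^ 2 * ((p + r) ^ 2 - p * r + 8 * z * (p + r) + 20 * z ^ 2) := by
    rw [hNdef]
    linear_combination 6400 * z * hprod
  linear_combination (1 / 6400) * h1 - (1 / 320) * V ^ 2 * hK +
    (1 / 6400) * (3 * r + 8 * z) ^ 2 * hD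

theorem differentiableAt_theta2Sum {t : ℂ} (ht : 0 < t.im) : DifferentiableAt ℂ theta2Sum t :=
  ((differentiableAt_theta2Sq ht).pow 2).add
    (((differentiableAt_comp_five (fun _ h => differentiableAt_theta2Sq h) ht).pow 2).const_mul 5)

theorem differentiableAt_theta4Sum {t : ℂ} (ht : 0 < t.im) : DifferentiableAt ℂ theta4Sum t :=
  ((differentiableAt_theta4Sq ht).pow 2).add
    (((differentiableAt_comp_five (fun _ h => differentiableAt_theta4Sq h) ht).pow 2).const_mul 5)

theorem tendsto_theta4Sum : Tendsto theta4Sum cuspInfty (𝓝 6) := by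
  have := (tendsto_theta4Sq.pow 2).add
    (((tendsto_theta4Sq.comp tendsto_five_mul).pow 2).const_mul 5)
  convert! this using 2
  norm_num

theorem eventually_theta4Sum_eq :
    ∀ᶠ t in cuspInfty, theta4Sum t = 6 * theta4Prod t + 16 * etaProd t := by
  have hM := (((tendsto_theta2Prod.add tendsto_theta4Prod).pow 2).sub
    (tendsto_theta2Prod.mul tendsto_theta4Prod)).add
    ((tendsto_etaProd.const_mul 8).mul (tendsto_theta2Prod.add tendsto_theta4Prod)) |>.add
    ((tendsto_etaProd.pow 2).const_mul 20)
  have hV := tendsto_theta4Sum.add ((tendsto_theta4Prod.const_mul 6).add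
    (tendsto_etaProd.const_mul 16))
  filter_upwards [eventually_im_pos, hM.eventually_ne (show _ ≠ (0 : ℂ) by norm_num),
    hV.eventually_ne (show _ ≠ (0 : ℂ) by norm_num)] with t ht h1 h2
  have h := theta4Sum_sq ht
  rw [mul_eq_zero, or_iff_right (mul_ne_zero (pow_ne_zero 2 (etaProd_ne_zero ht)) h1), sq_sub_sq,
    mul_eq_zero, or_iff_right h2, sub_eq_zero] at h
  exact h

/-- `θ₄(t)⁴ + 5θ₄(5t)⁴` as a linear form in the weight-two products. -/
theorem theta4Sum_eq {t : ℂ} (ht : 0 < t.im) :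
    theta4Sum t = 6 * theta4Prod t + 16 * etaProd t := by
  have h := eq_zero_of_eventually_cuspInfty
    (f := fun t => theta4Sum t - (6 * theta4Prod t + 16 * etaProd t))
    (fun s hs => (differentiableAt_theta4Sum hs).sub
      (((hasDerivAt_theta4Prod hs).differentiableAt.const_mul 6).add
        ((hasDerivAt_etaProd hs).differentiableAt.const_mul 16)))
    (eventually_theta4Sum_eq.mono fun s hs => sub_eq_zero.mpr hs) ht
  exact sub_eq_zero.mp h

/-- `θ₂(t)⁴ + 5θ₂(5t)⁴` as a linear form in the weight-two products. -/
theorem theta2Sum_eq {t : ℂ} (ht : 0 < t.im) :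
    theta2Sum t = 6 * theta2Prod t + 16 * etaProd t := by
  have hV := (tendsto_theta4Prod.const_mul 3).add (tendsto_etaProd.const_mul 8)
  have h := eq_zero_of_eventually_cuspInfty
    (f := fun t => theta2Sum t - (6 * theta2Prod t + 16 * etaProd t))
    (fun s hs => (differentiableAt_theta2Sum hs).sub
      (((hasDerivAt_theta2Prod hs).differentiableAt.const_mul 6).add
        ((hasDerivAt_etaProd hs).differentiableAt.const_mul 16))) ?_ ht
  · exact sub_eq_zero.mp h
  · filter_upwards [eventually_im_pos, hV.eventually_ne (show _ ≠ (0 : ℂ) by norm_num)] with s hs hne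
    have h1 := theta_sum_relation hs
    rw [theta4Sum_eq hs] at h1
    refine mul_right_cancel₀ hne ?_
    linear_combination -h1

/-- `D log η(t)² - D log η(5t)²`, a multiple of `E₂(t) - 5E₂(5t)`, obtained by differentiating
`theta4Sum_eq`. -/
theorem dlogEtaSq_sub {t : ℂ} (ht : 0 < t.im) :
    3 * (dlogEtaSq t - dlogEtaSqFive t) * (theta4Sq t ^ 2 - 5 * theta4Sq (5 * t) ^ 2) =
      8 * (theta4Prod t + 2 * etaProd t) * (theta4Prod t + 8 * etaProd t + 2 * theta2Prod t) := by
  have h5 := five_mul_im_pos ht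
  have hd := ((hasDerivAt_theta4Sq ht).fun_pow 2).fun_add
    (((hasDerivAt_comp_five (hasDerivAt_theta4Sq h5)).fun_pow 2).const_mul 5)
  have hd' := (((hasDerivAt_theta4Prod ht).const_mul 6).fun_add
    ((hasDerivAt_etaProd ht).const_mul 16)).congr_of_eventuallyEq (f₁ := theta4Sum) <| by
      filter_upwards [isOpen_upper.mem_nhds ht] with s hs using theta4Sum_eq hs
  have h := hd.unique hd'
  rw [jacobi_identity ht, jacobi_identity h5] at h
  have h' : 2 * theta4Sq t ^ 2 *
        (dlogEtaSq t - (2 * theta2Sq t ^ 2 + theta4Sq t ^ 2) / 6) +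
      10 * theta4Sq (5 * t) ^ 2 *
        (dlogEtaSqFive t - 5 * (2 * theta2Sq (5 * t) ^ 2 + theta4Sq (5 * t) ^ 2) / 6) =
      6 * theta4Prod t * (dlogEtaSq t + dlogEtaSqFive t - (2 * theta2Sum t + theta4Sum t) / 6) +
      16 * etaProd t * (dlogEtaSq t + dlogEtaSqFive t) := by
    refine mul_left_cancel₀ pi_mul_I_ne_zero (Eq.trans (Eq.trans ?_ h) ?_)
    · rw [dlogEtaSqFive]
      push_cast
      ring
    · ring
  have hV := theta4Sum_eq ht
  have hU := theta2Sum_eq ht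
  have hN := theta_mixed ht
  simp only [theta2Prod, theta4Prod, theta2Sum, theta4Sum] at h' hV hU hN ⊢
  generalize theta2Sq t = a, theta2Sq (5 * t) = a₅, theta4Sq t = b, theta4Sq (5 * t) = b₅,
    etaProd t = z, dlogEtaSq t = e, dlogEtaSqFive t = e₅ at h' hV hU hN ⊢
  linear_combination 3 * h' - 10 * hN +
    (2 * (b ^ 2 + 5 * b₅ ^ 2) - 6 * (b * b₅)) * hU +
    (2 * (6 * (a * a₅) + 16 * z) + (b ^ 2 + 5 * b₅ ^ 2) + (6 * (b * b₅) + 16 * z)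
      - 3 * (b * b₅) - 3 * (e + e₅)) * hV

theorem differentiableAt_dlogEtaSqFive {t : ℂ} (ht : 0 < t.im) :
    DifferentiableAt ℂ dlogEtaSqFive t :=
  (differentiableAt_comp_five (fun _ h => differentiableAt_dlogEtaSq h) ht).const_mul 5

/-- The square of the previous relation, in which `(θ₄(t)⁴ - 5θ₄(5t)⁴)² = V² - 20r²` is a polynomial
in `r` and `z` and cancels. -/
theorem dlogEtaSq_sub_sq {t : ℂ} (ht : 0 < t.im) :
    9 * theta4Prod t * (dlogEtaSq t - dlogEtaSqFive t) ^ 2 =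
      4 * (theta4Prod t + 2 * etaProd t) ^ 2 * (theta4Prod t + 4 * etaProd t) := by
  have hQ := ((tendsto_theta4Prod.pow 2).add ((tendsto_theta4Prod.const_mul 12).mul
    tendsto_etaProd)).add ((tendsto_etaProd.pow 2).const_mul 16)
  have h := eq_zero_of_eventually_cuspInfty
    (f := fun t => 9 * theta4Prod t * (dlogEtaSq t - dlogEtaSqFive t) ^ 2 -
      4 * (theta4Prod t + 2 * etaProd t) ^ 2 * (theta4Prod t + 4 * etaProd t)) ?_ ?_ ht
  · exact sub_eq_zero.mp h
  · intro s hs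
    have h1 := (hasDerivAt_theta4Prod hs).differentiableAt
    have h2 := (hasDerivAt_etaProd hs).differentiableAt
    have h3 := differentiableAt_dlogEtaSq hs
    have h4 := differentiableAt_dlogEtaSqFive hs
    fun_prop
  · filter_upwards [eventually_im_pos, hQ.eventually_ne (show _ ≠ (0 : ℂ) by norm_num)] with s hs hne
    have h1 := dlogEtaSq_sub hs
    have hprod := theta_prod_mul hs
    rw [modular_equation hs] at hprod
    have h2 : (theta4Sq s ^ 2 - 5 * theta4Sq (5 * s) ^ 2) ^ 2 =
        16 * (theta4Prod s ^ 2 + 12 * theta4Prod s * etaProd s + 16 * etaProd s ^ 2) := by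
      have h3 : theta4Sum s ^ 2 = (6 * theta4Prod s + 16 * etaProd s) ^ 2 := by
        rw [theta4Sum_eq hs]
      simp only [theta4Sum, theta4Prod] at h3 ⊢
      linear_combination h3
    have h4 : theta4Prod s * (theta4Prod s + 8 * etaProd s + 2 * theta2Prod s) ^ 2 =
        (theta4Prod s + 4 * etaProd s) *
          (theta4Prod s ^ 2 + 12 * theta4Prod s * etaProd s + 16 * etaProd s ^ 2) := by
      linear_combination 4 * hprod
    have h5 := congrArg (· ^ 2) h1
    simp only [mul_pow] at h5
    rw [h2] at h5
    refine (mul_eq_zero.mp ?_).resolve_right hne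
    linear_combination (1 / 16) * theta4Prod s * h5 +
      4 * (theta4Prod s + 2 * etaProd s) ^ 2 * h4

/-- `D log Z`, with `Z = θ₃(t)²θ₃(5t)²`. -/
def dlogTheta3Prod (t : ℂ) : ℂ :=
  dlogEtaSq t + dlogEtaSqFive t + theta2Prod t - theta4Prod t

theorem hasDerivAt_theta3Prod_dlog {t : ℂ} (ht : 0 < t.im) :
    HasDerivAt theta3Prod (π * I * (theta3Prod t * dlogTheta3Prod t)) t := by
  refine (hasDerivAt_theta3Prod ht).congr_deriv ?_
  rw [theta2Sum_eq ht, theta4Sum_eq ht, dlogTheta3Prod]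
  ring

/-- The second-order (Rankin–Cohen) identity for `Z`:
`2 D²(log Z) - (D log Z)² = 8z(Z² - 10zZ + 18z²)/Z`. -/
theorem hasDerivAt_dlogTheta3Prod {t : ℂ} (ht : 0 < t.im) :
    HasDerivAt dlogTheta3Prod (π * I * (dlogTheta3Prod t ^ 2 / 2 +
      4 * etaProd t * (theta3Prod t ^ 2 - 10 * etaProd t * theta3Prod t + 18 * etaProd t ^ 2) /
        theta3Prod t)) t := by
  have h5 := five_mul_im_pos ht
  have hZ0 := theta3Prod_ne_zero ht
  have hr0 := theta4Prod_ne_zero ht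
  have hd := (((hasDerivAt_dlogEtaSq ht).fun_add
    ((hasDerivAt_comp_five (hasDerivAt_dlogEtaSq h5)).const_mul 5)).fun_add
    (hasDerivAt_theta2Prod ht)).fun_sub (hasDerivAt_theta4Prod ht)
  refine hd.congr_deriv ?_
  have hprod := theta_prod_mul ht
  have hm := modular_equation ht
  have hV := theta4Sum_eq ht
  have hU := theta2Sum_eq ht
  have hN := theta_mixed ht
  have hδ := dlogEtaSq_sub_sq ht
  have hC : theta3Sq t ^ 4 = (theta2Sq t ^ 2 + theta4Sq t ^ 2) ^ 2 := by
    rw [← jacobi_identity ht]; ring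
  have hC5 : theta3Sq (5 * t) ^ 4 = (theta2Sq (5 * t) ^ 2 + theta4Sq (5 * t) ^ 2) ^ 2 := by
    rw [← jacobi_identity h5]; ring
  have hW : theta2Sq t ^ 4 + theta2Sq t ^ 2 * theta4Sq t ^ 2 + theta4Sq t ^ 4 +
      25 * (theta2Sq (5 * t) ^ 4 + theta2Sq (5 * t) ^ 2 * theta4Sq (5 * t) ^ 2 +
        theta4Sq (5 * t) ^ 4) =
      26 * (theta2Prod t ^ 2 + theta4Prod t ^ 2) + 26 * theta2Prod t * theta4Prod t +
        208 * etaProd t * (theta2Prod t + theta4Prod t) + 448 * etaProd t ^ 2 := by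
    simp only [theta2Prod, theta4Prod, theta2Sum, theta4Sum] at hV hU hN ⊢
    generalize theta2Sq t = a, theta2Sq (5 * t) = a₅, theta4Sq t = b, theta4Sq (5 * t) = b₅,
      etaProd t = z at hV hU hN ⊢
    linear_combination -5 * hN +
      ((a ^ 2 + 5 * a₅ ^ 2) + (6 * (a * a₅) + 16 * z) + (b ^ 2 + 5 * b₅ ^ 2)) * hU +
      ((b ^ 2 + 5 * b₅ ^ 2) + (6 * (b * b₅) + 16 * z) + (6 * (a * a₅) + 16 * z)) * hV
  have key : theta3Prod t * ((dlogEtaSq t - dlogEtaSqFive t) ^ 2 -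
      (theta2Sq t ^ 4 + theta2Sq t ^ 2 * theta4Sq t ^ 2 + theta4Sq t ^ 4 +
      25 * (theta2Sq (5 * t) ^ 4 + theta2Sq (5 * t) ^ 2 * theta4Sq (5 * t) ^ 2 +
        theta4Sq (5 * t) ^ 4)) / 18 +
      theta2Prod t * (2 * theta4Sum t + theta2Sum t) / 3 +
      theta4Prod t * (2 * theta2Sum t + theta4Sum t) / 3 - (theta2Prod t - theta4Prod t) ^ 2) =
      8 * etaProd t *
        (theta3Prod t ^ 2 - 10 * etaProd t * theta3Prod t + 18 * etaProd t ^ 2) := by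
    refine mul_left_cancel₀ hr0 ?_
    rw [hW, hU, hV]
    rw [hm] at hprod ⊢
    linear_combination (1 / 9) * (theta2Prod t + theta4Prod t + 8 * etaProd t) * hδ +
      (1 / 9) * (81 * theta4Prod t - 4 * (theta2Prod t + theta4Prod t + 8 * etaProd t)) * hprod
  have key' : 4 * etaProd t *
      (theta3Prod t ^ 2 - 10 * etaProd t * theta3Prod t + 18 * etaProd t ^ 2) / theta3Prod t =
      ((dlogEtaSq t - dlogEtaSqFive t) ^ 2 -
      (theta2Sq t ^ 4 + theta2Sq t ^ 2 * theta4Sq t ^ 2 + theta4Sq t ^ 4 +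
      25 * (theta2Sq (5 * t) ^ 4 + theta2Sq (5 * t) ^ 2 * theta4Sq (5 * t) ^ 2 +
        theta4Sq (5 * t) ^ 4)) / 18 +
      theta2Prod t * (2 * theta4Sum t + theta2Sum t) / 3 +
      theta4Prod t * (2 * theta2Sum t + theta4Sum t) / 3 -
        (theta2Prod t - theta4Prod t) ^ 2) / 2 := by
    rw [div_eq_iff hZ0]
    linear_combination -(1 / 2) * key
  rw [key', hC, hC5, dlogTheta3Prod, dlogEtaSqFive]
  ring

/-! ### The differential equation -/

theorem two_mul_im_pos {τ : ℂ} (hτ : 0 < τ.im) : 0 < (2 * τ).im := by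
  simpa using hτ

theorem Z_eq_theta3Prod (τ : ℂ) : Z τ = theta3Prod (2 * τ) := by
  have hq : nome τ ≠ 0 := Complex.exp_ne_zero _
  have h1 : ∀ m : ℤ, nome τ ^ (m ^ 2) = exp (π * I * (m : ℂ) ^ 2 * (2 * τ)) := by
    intro m
    rw [nome, ← Complex.exp_int_mul]
    congr 1
    push_cast
    ring
  have h2 : ∀ n : ℤ, nome τ ^ (5 * n ^ 2) = exp (π * I * (n : ℂ) ^ 2 * (5 * (2 * τ))) := by
    intro n
    rw [nome, ← Complex.exp_int_mul]
    congr 1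
    push_cast
    ring
  have h : ∑' m : ℤ, ∑' n : ℤ, nome τ ^ (m ^ 2 + 5 * n ^ 2) =
      jacobiTheta (2 * τ) * jacobiTheta (5 * (2 * τ)) := by
    simp only [zpow_add₀ hq, h1, h2]
    rw [jacobiTheta, jacobiTheta, ← tsum_mul_right]
    exact tsum_congr fun m => tsum_mul_left
  rw [Z, h, theta3Prod, theta3Sq, theta3Sq, mul_pow]

theorem z_eq_etaProd (τ : ℂ) : z τ = etaProd (2 * τ) := by
  rw [z, etaProd, etaSq, etaSq, show 5 * (2 * τ) = 10 * τ by ring]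

theorem Z_ne_zero {τ : ℂ} (hτ : 0 < τ.im) : Z τ ≠ 0 := by
  rw [Z_eq_theta3Prod]
  exact theta3Prod_ne_zero (two_mul_im_pos hτ)

theorem X_ne_zero {τ : ℂ} (hτ : 0 < τ.im) : X τ ≠ 0 := by
  rw [X, z_eq_etaProd]
  exact div_ne_zero (etaProd_ne_zero (two_mul_im_pos hτ)) (Z_ne_zero hτ)

/-- The logarithmic derivative `(2πi)⁻¹ Z'/Z`. -/
def dlogZ (τ : ℂ) : ℂ := dlogTheta3Prod (2 * τ)

/-- The logarithmic derivative `(2πi)⁻¹ X'/X`, which is a holomorphic form of weight two. -/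
def dlogX (τ : ℂ) : ℂ := theta4Prod (2 * τ) - theta2Prod (2 * τ)

theorem hasDerivAt_comp_two {f : ℂ → ℂ} {a τ : ℂ} (hf : HasDerivAt f (π * I * a) (2 * τ)) :
    HasDerivAt (fun s => f (2 * s)) (2 * π * I * a) τ := by
  have h2 : HasDerivAt (fun s : ℂ => 2 * s) 2 τ := by simpa using (hasDerivAt_id τ).const_mul 2
  exact (HasDerivAt.comp τ hf h2).congr_deriv (by ring)

theorem hasDerivAt_Z {τ : ℂ} (hτ : 0 < τ.im) :
    HasDerivAt Z (2 * π * I * (Z τ * dlogZ τ)) τ := by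
  rw [funext Z_eq_theta3Prod]
  exact hasDerivAt_comp_two (hasDerivAt_theta3Prod_dlog (two_mul_im_pos hτ))

theorem hasDerivAt_X {τ : ℂ} (hτ : 0 < τ.im) :
    HasDerivAt X (2 * π * I * (X τ * dlogX τ)) τ := by
  have h1 : HasDerivAt z (2 * π * I * (z τ * (dlogEtaSq (2 * τ) + dlogEtaSqFive (2 * τ)))) τ := by
    rw [funext z_eq_etaProd]
    exact hasDerivAt_comp_two (hasDerivAt_etaProd (two_mul_im_pos hτ))
  have h0 := Z_ne_zero hτ
  refine (h1.fun_div (hasDerivAt_Z hτ) h0).congr_deriv ?_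
  rw [X, dlogX, dlogZ, dlogTheta3Prod]
  field_simp
  ring

theorem hasDerivAt_dlogZ {τ : ℂ} (hτ : 0 < τ.im) :
    HasDerivAt dlogZ (2 * π * I * (dlogZ τ ^ 2 / 2 +
      Z τ ^ 2 * (4 * X τ - 40 * X τ ^ 2 + 72 * X τ ^ 3))) τ := by
  refine (hasDerivAt_comp_two (hasDerivAt_dlogTheta3Prod (two_mul_im_pos hτ))).congr_deriv ?_
  have h0 := Z_ne_zero hτ
  rw [← Z_eq_theta3Prod, ← z_eq_etaProd, ← dlogZ, X]
  field_simp
  ring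

/-- `(D log X)² = Z²(1 - 4X)(1 - 12X + 16X²)`: the discriminant of the quadratic polynomial with
roots `θ₂²θ₂²(5·)/Z` and `θ₄²θ₄²(5·)/Z`, whose sum is `1 - 8X` and whose product is `16X³`. -/
theorem dlogX_sq {τ : ℂ} (hτ : 0 < τ.im) :
    dlogX τ ^ 2 = Z τ ^ 2 * (1 - 16 * X τ + 64 * X τ ^ 2 - 64 * X τ ^ 3) := by
  have h0 := Z_ne_zero hτ
  have h1 := modular_equation (two_mul_im_pos hτ)
  have h2 := theta_prod_mul (two_mul_im_pos hτ)
  rw [← Z_eq_theta3Prod, ← z_eq_etaProd] at h1 h2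
  rw [dlogX, X]
  generalize theta2Prod (2 * τ) = p, theta4Prod (2 * τ) = r at h1 h2 ⊢
  field_simp
  linear_combination -4 * h2 - Z τ * (Z τ - 8 * z τ + (p + r)) * h1

theorem differentiableAt_dlogX {τ : ℂ} (hτ : 0 < τ.im) : DifferentiableAt ℂ dlogX τ :=
  ((hasDerivAt_comp_two (hasDerivAt_theta4Prod (two_mul_im_pos hτ))).fun_sub
    (hasDerivAt_comp_two (hasDerivAt_theta2Prod (two_mul_im_pos hτ)))).differentiableAt

/-- Obtained from `dlogX_sq`, hence only where `dlogX τ ≠ 0`. -/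
theorem hasDerivAt_dlogX {τ : ℂ} (hτ : 0 < τ.im) (hs : dlogX τ ≠ 0) :
    HasDerivAt dlogX (2 * π * I * (dlogX τ * dlogZ τ +
      Z τ ^ 2 * (-8 * X τ + 64 * X τ ^ 2 - 96 * X τ ^ 3))) τ := by
  refine (differentiableAt_dlogX hτ).hasDerivAt.congr_deriv ?_
  have hX := hasDerivAt_X hτ
  have h1 := (differentiableAt_dlogX hτ).hasDerivAt.fun_pow 2
  have h2 := ((hasDerivAt_Z hτ).fun_pow 2).fun_mul ((((hX.const_mul 16).const_sub 1).fun_add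
    ((hX.fun_pow 2).const_mul 64)).fun_sub ((hX.fun_pow 3).const_mul 64))
  have h3 := h1.unique <| h2.congr_of_eventuallyEq <| by
    filter_upwards [isOpen_upper.mem_nhds hτ] with s hs using dlogX_sq hs
  have h4 := dlogX_sq hτ
  refine mul_left_cancel₀ hs ?_
  push_cast at h3
  linear_combination (1 / 2) * h3 - 2 * π * I * dlogZ τ * h4

theorem deriv_X_ne_zero_iff {τ : ℂ} (hτ : 0 < τ.im) : deriv X τ ≠ 0 ↔ dlogX τ ≠ 0 := by
  rw [(hasDerivAt_X hτ).deriv]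
  simp [X_ne_zero hτ, Real.pi_ne_zero]

theorem eulerX_eq (f : ℂ → ℂ) {τ : ℂ} (hτ : 0 < τ.im) :
    eulerX f τ = deriv f τ / (2 * π * I * dlogX τ) := by
  have := X_ne_zero hτ
  rw [eulerX, dX, (hasDerivAt_X hτ).deriv,
    show 2 * π * I * (X τ * dlogX τ) = X τ * (2 * π * I * dlogX τ) by ring, ← mul_div_assoc,
    mul_div_mul_left _ _ this]

/-- Where `dX/dτ ≠ 0`, the derivative is recovered from the Euler operator. -/
theorem hasDerivAt_of_eulerX {f : ℂ → ℂ} {τ : ℂ} (hτ : 0 < τ.im) (hs : dlogX τ ≠ 0)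
    (hf : DifferentiableAt ℂ f τ) : HasDerivAt f (2 * π * I * (dlogX τ * eulerX f τ)) τ := by
  refine hf.hasDerivAt.congr_deriv ?_
  have := Complex.two_pi_I_ne_zero
  rw [eulerX_eq f hτ, ← mul_assoc, mul_div_cancel₀ _ (mul_ne_zero this hs)]

theorem eulerX_of_hasDerivAt {f : ℂ → ℂ} {a τ : ℂ} (hτ : 0 < τ.im)
    (hf : HasDerivAt f (2 * π * I * a) τ) : eulerX f τ = a / dlogX τ := by
  rw [eulerX_eq f hτ, hf.deriv, mul_div_mul_left _ _ Complex.two_pi_I_ne_zero]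

theorem isOpen_regular : IsOpen {τ : ℂ | 0 < τ.im ∧ dlogX τ ≠ 0} := by
  have hc : ContinuousOn dlogX {τ : ℂ | 0 < τ.im} := fun s hs =>
    (differentiableAt_dlogX hs).continuousAt.continuousWithinAt
  exact hc.isOpen_inter_preimage isOpen_upper isOpen_compl_singleton

theorem eventually_regular {τ : ℂ} (hτ : 0 < τ.im) (hs : dlogX τ ≠ 0) :
    ∀ᶠ s in 𝓝 τ, 0 < s.im ∧ dlogX s ≠ 0 :=
  isOpen_regular.mem_nhds ⟨hτ, hs⟩

theorem eulerX_Z {τ : ℂ} (hτ : 0 < τ.im) :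
    eulerX Z τ = Z τ * dlogZ τ / dlogX τ :=
  eulerX_of_hasDerivAt hτ (hasDerivAt_Z hτ)

theorem differentiableAt_eulerX_Z {τ : ℂ} (hτ : 0 < τ.im) (hs : dlogX τ ≠ 0) :
    DifferentiableAt ℂ (eulerX Z) τ := by
  have h := ((hasDerivAt_Z hτ).fun_mul (hasDerivAt_dlogZ hτ)).fun_div (hasDerivAt_dlogX hτ hs) hs
  exact (h.congr_of_eventuallyEq <| by
    filter_upwards [eventually_regular hτ hs] with s h using eulerX_Z h.1).differentiableAt

theorem eulerX_eulerX_Z {τ : ℂ} (hτ : 0 < τ.im) (hs : dlogX τ ≠ 0) :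
    eulerX (eulerX Z) τ = Z τ * (dlogZ τ ^ 2 / 2 +
      Z τ ^ 2 * (4 * X τ - 40 * X τ ^ 2 + 72 * X τ ^ 3) -
      dlogZ τ * Z τ ^ 2 * (-8 * X τ + 64 * X τ ^ 2 - 96 * X τ ^ 3) / dlogX τ) / dlogX τ ^ 2 := by
  have h := ((hasDerivAt_Z hτ).fun_mul (hasDerivAt_dlogZ hτ)).fun_div (hasDerivAt_dlogX hτ hs) hs
  have h1 := h.congr_of_eventuallyEq (f₁ := eulerX Z) <| by
    filter_upwards [eventually_regular hτ hs] with s h using eulerX_Z h.1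
  rw [eulerX_eq _ hτ, h1.deriv]
  have := Complex.two_pi_I_ne_zero
  generalize (2 * π * I : ℂ) = c at this ⊢
  field_simp
  ring

theorem differentiableAt_eulerX_eulerX_Z {τ : ℂ} (hτ : 0 < τ.im) (hs : dlogX τ ≠ 0) :
    DifferentiableAt ℂ (eulerX (eulerX Z)) τ := by
  have hZ := (hasDerivAt_Z hτ).differentiableAt
  have hX := (hasDerivAt_X hτ).differentiableAt
  have hl := (hasDerivAt_dlogZ hτ).differentiableAt
  have hd := differentiableAt_dlogX hτ
  have h : DifferentiableAt ℂ (fun τ => Z τ * (dlogZ τ ^ 2 / 2 +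
      Z τ ^ 2 * (4 * X τ - 40 * X τ ^ 2 + 72 * X τ ^ 3) -
      dlogZ τ * Z τ ^ 2 * (-8 * X τ + 64 * X τ ^ 2 - 96 * X τ ^ 3) / dlogX τ) / dlogX τ ^ 2) τ := by
    have h1 : DifferentiableAt ℂ (fun τ => Z τ * (dlogZ τ ^ 2 / 2 +
        Z τ ^ 2 * (4 * X τ - 40 * X τ ^ 2 + 72 * X τ ^ 3) -
        dlogZ τ * Z τ ^ 2 * (-8 * X τ + 64 * X τ ^ 2 - 96 * X τ ^ 3) / dlogX τ)) τ := by
      refine hZ.fun_mul (DifferentiableAt.fun_sub (by fun_prop) (DifferentiableAt.fun_div ?_ hd hs))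
      fun_prop
    exact h1.fun_div (hd.fun_pow 2) (pow_ne_zero 2 hs)
  refine h.congr_of_eventuallyEq ?_
  filter_upwards [eventually_regular hτ hs] with s h using eulerX_eulerX_Z h.1 h.2

/-- The second-order nonlinear equation whose derivative is the third-order linear one. -/
theorem eulerX_quadratic {τ : ℂ} (hτ : 0 < τ.im) (hs : dlogX τ ≠ 0) :
    2 * (Z τ * (1 - 16 * X τ + 64 * X τ ^ 2 - 64 * X τ ^ 3) * eulerX (eulerX Z) τ) -
      (1 - 16 * X τ + 64 * X τ ^ 2 - 64 * X τ ^ 3) * eulerX Z τ ^ 2 +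
      Z τ * (-16 * X τ + 128 * X τ ^ 2 - 192 * X τ ^ 3) * eulerX Z τ -
      Z τ ^ 2 * (8 * X τ - 80 * X τ ^ 2 + 144 * X τ ^ 3) = 0 := by
  have h0 := Z_ne_zero hτ
  have hP : 1 - 16 * X τ + 64 * X τ ^ 2 - 64 * X τ ^ 3 = dlogX τ ^ 2 / Z τ ^ 2 := by
    rw [dlogX_sq hτ]
    field_simp
  rw [hP, eulerX_Z hτ, eulerX_eulerX_Z hτ hs]
  field_simp
  ring

/-- The linear equation in terms of `X d/dX`: the derivative of `eulerX_quadratic`, divided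
by `Z`. -/
theorem eulerX_cubic {τ : ℂ} (hτ : 0 < τ.im) (hs : dlogX τ ≠ 0) :
    4 * X τ * (54 * X τ ^ 2 - 20 * X τ + 1) * Z τ
      + 16 * X τ * (27 * X τ ^ 2 - 13 * X τ + 1) * eulerX Z τ
      + 24 * X τ * (2 * X τ - 1) * (6 * X τ - 1) * eulerX (eulerX Z) τ
      + (4 * X τ - 1) * (16 * X τ ^ 2 - 12 * X τ + 1) * eulerX (eulerX (eulerX Z)) τ = 0 := by
  have hX := hasDerivAt_X hτ
  have hZ := hasDerivAt_of_eulerX hτ hs (hasDerivAt_Z hτ).differentiableAt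
  have h1 := hasDerivAt_of_eulerX hτ hs (differentiableAt_eulerX_Z hτ hs)
  have h2 := hasDerivAt_of_eulerX hτ hs (differentiableAt_eulerX_eulerX_Z hτ hs)
  have hP := (((hX.const_mul 16).const_sub 1).fun_add
    ((hX.fun_pow 2).const_mul 64)).fun_sub ((hX.fun_pow 3).const_mul 64)
  have hQ := ((hX.const_mul (-16)).fun_add
    ((hX.fun_pow 2).const_mul 128)).fun_sub ((hX.fun_pow 3).const_mul 192)
  have hR := ((hX.const_mul 8).fun_sub
    ((hX.fun_pow 2).const_mul 80)).fun_add ((hX.fun_pow 3).const_mul 144)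
  have hG := (((((hZ.fun_mul hP).fun_mul h2).const_mul 2).fun_sub (hP.fun_mul (h1.fun_pow 2))).fun_add
    ((hZ.fun_mul hQ).fun_mul h1)).fun_sub ((hZ.fun_pow 2).fun_mul hR)
  have hG0 := (hasDerivAt_const τ (0 : ℂ)).congr_of_eventuallyEq <| by
    filter_upwards [eventually_regular hτ hs] with s h using eulerX_quadratic h.1 h.2
  have h := hG.unique hG0
  have hne : (2 * π * I : ℂ) * dlogX τ * Z τ ≠ 0 :=
    mul_ne_zero (mul_ne_zero Complex.two_pi_I_ne_zero hs) (Z_ne_zero hτ)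
  refine mul_left_cancel₀ hne ?_
  push_cast at h
  linear_combination -(1 / 2) * h

theorem dX_eq_eulerX (f : ℂ → ℂ) {τ : ℂ} (hτ : 0 < τ.im) : dX f τ = eulerX f τ / X τ := by
  rw [eulerX, mul_div_cancel_left₀ _ (X_ne_zero hτ)]

theorem dX_dX_eq {f : ℂ → ℂ} {τ : ℂ} (hτ : 0 < τ.im) (hs : dlogX τ ≠ 0)
    (h1 : DifferentiableAt ℂ (eulerX f) τ) :
    dX (dX f) τ = (eulerX (eulerX f) τ - eulerX f τ) / X τ ^ 2 := by
  have h0 := X_ne_zero hτ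
  have h := ((hasDerivAt_of_eulerX hτ hs h1).fun_div (hasDerivAt_X hτ) h0).congr_of_eventuallyEq
    (f₁ := dX f) <| by
      filter_upwards [isOpen_upper.mem_nhds hτ] with s h using dX_eq_eulerX f h
  rw [dX_eq_eulerX _ hτ, eulerX_eq _ hτ, h.deriv]
  have := Complex.two_pi_I_ne_zero
  generalize (2 * π * I : ℂ) = c at this ⊢
  field_simp

theorem dX_dX_dX_eq {f : ℂ → ℂ} {τ : ℂ} (hτ : 0 < τ.im) (hs : dlogX τ ≠ 0)
    (h1 : ∀ s : ℂ, 0 < s.im → dlogX s ≠ 0 → DifferentiableAt ℂ (eulerX f) s)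
    (h2 : DifferentiableAt ℂ (eulerX (eulerX f)) τ) :
    dX (dX (dX f)) τ =
      (eulerX (eulerX (eulerX f)) τ - 3 * eulerX (eulerX f) τ + 2 * eulerX f τ) / X τ ^ 3 := by
  have h0 := X_ne_zero hτ
  have h := (((hasDerivAt_of_eulerX hτ hs h2).fun_sub
    (hasDerivAt_of_eulerX hτ hs (h1 τ hτ hs))).fun_div ((hasDerivAt_X hτ).fun_pow 2)
    (pow_ne_zero 2 h0)).congr_of_eventuallyEq (f₁ := dX (dX f)) <| by
      filter_upwards [eventually_regular hτ hs] with s h using dX_dX_eq h.1 h.2 (h1 s h.1 h.2)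
  rw [dX_eq_eulerX _ hτ, eulerX_eq _ hτ, h.deriv]
  have := Complex.two_pi_I_ne_zero
  generalize (2 * π * I : ℂ) = c at this ⊢
  field_simp
  push_cast
  ring

/-- The zeros of `dX/dτ` are isolated, since `D log X` is holomorphic and tends to `1` at the
cusp. -/
theorem eventually_dlogX_ne_zero : ∀ᶠ τ in codiscreteWithin {τ : ℂ | 0 < τ.im}, dlogX τ ≠ 0 := by
  have hd : DifferentiableOn ℂ dlogX {τ : ℂ | 0 < τ.im} := fun s hs =>
    (differentiableAt_dlogX hs).differentiableWithinAt
  refine ((hd.analyticOnNhd isOpen_upper).eqOn_zero_or_eventually_ne_zero_of_preconnected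
    (convex_halfSpace_im_gt 0).isPreconnected).resolve_left fun h => ?_
  have hlim : Tendsto dlogX cuspInfty (𝓝 (1 - 0)) := by
    have h2 : Tendsto (fun t : ℂ => 2 * t) cuspInfty cuspInfty := by
      simpa using tendsto_mul_cuspInfty (c := 2) (by norm_num)
    exact (tendsto_theta4Prod.comp h2).sub (tendsto_theta2Prod.comp h2)
  have hlim0 : Tendsto dlogX cuspInfty (𝓝 0) :=
    tendsto_const_nhds.congr' <| by
      filter_upwards [eventually_im_pos] with s hs using (h hs).symm
  have := tendsto_nhds_unique hlim hlim0
  norm_num at this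

end LevelTwenty

end

theorem mainTheorem2 :
    (∀ᶠ τ in Filter.codiscreteWithin {τ : ℂ | 0 < τ.im},
      LevelTwenty.Z τ ≠ 0 ∧ deriv LevelTwenty.X τ ≠ 0) ∧
    ∀ τ : ℂ, 0 < τ.im → LevelTwenty.Z τ ≠ 0 → deriv LevelTwenty.X τ ≠ 0 →
      (LevelTwenty.X τ ^ 2 * (1 - 4 * LevelTwenty.X τ)
            * (1 - 12 * LevelTwenty.X τ + 16 * LevelTwenty.X τ ^ 2)
            * LevelTwenty.dX (LevelTwenty.dX (LevelTwenty.dX LevelTwenty.Z)) τ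
          + 3 * LevelTwenty.X τ
            * (1 - 24 * LevelTwenty.X τ + 128 * LevelTwenty.X τ ^ 2 - 160 * LevelTwenty.X τ ^ 3)
            * LevelTwenty.dX (LevelTwenty.dX LevelTwenty.Z) τ
          + (1 - 56 * LevelTwenty.X τ + 464 * LevelTwenty.X τ ^ 2 - 784 * LevelTwenty.X τ ^ 3)
            * LevelTwenty.dX LevelTwenty.Z τ
          - 4 * (1 - 20 * LevelTwenty.X τ + 54 * LevelTwenty.X τ ^ 2) * LevelTwenty.Z τ = 0) ∧
      (4 * LevelTwenty.X τ * (54 * LevelTwenty.X τ ^ 2 - 20 * LevelTwenty.X τ + 1)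
            * LevelTwenty.Z τ
          + 16 * LevelTwenty.X τ * (27 * LevelTwenty.X τ ^ 2 - 13 * LevelTwenty.X τ + 1)
            * LevelTwenty.eulerX LevelTwenty.Z τ
          + 24 * LevelTwenty.X τ * (2 * LevelTwenty.X τ - 1) * (6 * LevelTwenty.X τ - 1)
            * LevelTwenty.eulerX (LevelTwenty.eulerX LevelTwenty.Z) τ
          + (4 * LevelTwenty.X τ - 1) * (16 * LevelTwenty.X τ ^ 2 - 12 * LevelTwenty.X τ + 1)
            * LevelTwenty.eulerX (LevelTwenty.eulerX (LevelTwenty.eulerX LevelTwenty.Z)) τ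
          = 0) := by
  refine ⟨?_, fun τ hτ _ hX => ?_⟩
  · filter_upwards [LevelTwenty.eventually_dlogX_ne_zero, Filter.self_mem_codiscreteWithin _]
      with τ h hτ
    exact ⟨LevelTwenty.Z_ne_zero hτ, (LevelTwenty.deriv_X_ne_zero_iff hτ).mpr h⟩
  · have hs := (LevelTwenty.deriv_X_ne_zero_iff hτ).mp hX
    have h := LevelTwenty.eulerX_cubic hτ hs
    refine ⟨?_, h⟩
    have h0 := LevelTwenty.X_ne_zero hτ
    have h1 := LevelTwenty.differentiableAt_eulerX_Z hτ hs
    have h2 := LevelTwenty.differentiableAt_eulerX_eulerX_Z hτ hs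
    rw [LevelTwenty.dX_dX_dX_eq hτ hs (fun _ => LevelTwenty.differentiableAt_eulerX_Z) h2,
      LevelTwenty.dX_dX_eq hτ hs h1, LevelTwenty.dX_eq_eulerX _ hτ]
    refine mul_left_cancel₀ h0 ?_
    field_simp
    linear_combination -h
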